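/- Let $d\ge 1$ be an integer and $u\in\mathbb C\setminus\{0\}$. For $n\ge 0$ let $\mathrm Y_{d,n}(u)$ be the Yokonuma--Hecke algebra: the unital associative $\mathbb C$-algebra generated by $g_1,\dots,g_{n-1},t_1,\dots,t_n$ with relations $g_ig_j=g_jg_i$ for $|i-j|>1$, $g_ig_{i+1}g_i=g_{i+1}g_ig_{i+1}$, $t_it_j=t_jt_i$, $t_jg_i=g_it_{s_i(j)}$ (where $s_i$ is the transposition $(i,i+1)$), $t_j^d=1$, and $g_i^2=1+(u-1)e_i+(u-1)e_ig_i$, where $e_i=\frac1d\sum_{s=0}^{d-1}t_i^st_{i+1}^{d-s}$. (For $n=0$ it is $\mathbb C$.) Let $\iota_n:\mathrm Y_{d,n}(u)\to\mathrm Y_{d,n+1}(u)$ be the homomorphism that sends each generator to the generator of the same name. Let $z\in\mathbb C$ and let $x:\mathbb Z/d\mathbb Z\to\mathbb C$, $m\mapsto x_m$, with $x_0=1$. The Juyumaya trace with parameters $z,x_1,\dots,x_{d-1}$ is the unique family of linear maps $\mathrm{tr}=\mathrm{tr}_n:\mathrm Y_{d,n}(u)\to\mathbb C$ (such a family exists and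 is unique) with $\mathrm{tr}_{n+1}\circ\iota_n=\mathrm{tr}_n$, $\mathrm{tr}(1)=1$, $\mathrm{tr}(ab)=\mathrm{tr}(ba)$ for $a,b\in \mathrm Y_{d,n}(u)$, $\mathrm{tr}(\iota_n(a)\,g_n)=z\,\mathrm{tr}(a)$ for $n\ge1$, $a\in \mathrm Y_{d,n}(u)$, and $\mathrm{tr}(\iota_n(a)\,t_{n+1}^m)=x_m\,\mathrm{tr}(a)$ for $a\in \mathrm Y_{d,n}(u)$, $1\le m\le d-1$. For $n\ge 3$ let $\mathrm{FTL}_{d,n}(u)$ be the quotient of $\mathrm Y_{d,n}(u)$ by the two-sided ideal generated by the elements $e_ie_{i+1}g_{i,i+1}$, $1\le i\le n-2$, where $g_{i,i+1}=g_ig_{i+1}g_i+g_{i+1}g_i+g_ig_{i+1}+g_i+g_{i+1}+1$. The trace passes to $\mathrm{FTL}_{d,n}(u)$ if $\mathrm{tr}_n$ factors through the quotient map. Write $\exp(j)=e^{2\pi i j/d}$ for $j\in\mathbb Z/d\mathbb Z$, let $y_k=\sum_{m\in\mathbb Z/d\mathbb Z}x_m\exp(-km)$ be the values of the Fourier transform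 $\widehat x$ of $x$, and let $$D_1=\{k\in\operatorname{supp}\widehat x : y_k=-dz\},\qquad D_2=\{k\in\operatorname{supp}\widehat x : y_k=-dz(u+1)\}.$$ **Theorem.** For every $n\ge3$, the trace $\mathrm{tr}$ passes to $\mathrm{FTL}_{d,n}(u)$ if and only if $$x_m=-z\Bigl(\sum_{k\in D_1}\exp(km)+(u+1)\sum_{k\in D_2}\exp(km)\Bigr)\quad\text{for all } m\in\mathbb Z/d\mathbb Z$$ and $$|D_1|+(u+1)|D_2|\neq0,\qquad z=-\frac{1}{|D_1|+(u+1)|D_2|}.$$ Moreover, in this case $D_1$ and $D_2$ are disjoint and $D_1\cup D_2$ is the support of $\widehat x$. -/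

import Mathlib

noncomputable section

/-- Generators of the Yokonuma-Hecke algebra on `n` strands, with indices starting at `0`:
the braiding generators `g i` for `0 ≤ i < n - 1` (the strands `i` and `i + 1`) and the framing
generators `t j` for `0 ≤ j < n`. -/
inductive YHGen (n : ℕ) : Type
  | g (i : ℕ) (hi : i + 1 < n) : YHGen n
  | t (j : ℕ) (hj : j < n) : YHGen n

/-- The expression `(1/d) ∑_{s=0}^{d-1} a^s b^(d-s)` in a complex algebra. With `a = t_i` and
`b = t_{i+1}` this is the element `e_i`. -/
def yhE {A : Type*} [Ring A] [Algebra ℂ A] (d : ℕ) (a b : A) : A :=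
  (1 / (d : ℂ)) • ∑ s ∈ Finset.range d, a ^ s * b ^ (d - s)

theorem yh_swap_lt {n i j : ℕ} (hi : i + 1 < n) (hj : j < n) :
    Equiv.swap i (i + 1) j < n := by
  rw [Equiv.swap_apply_def]
  split_ifs <;> omega

namespace YHGen

/-- The braiding generator as an element of the free algebra. -/
def G {n : ℕ} (i : ℕ) (hi : i + 1 < n) : FreeAlgebra ℂ (YHGen n) :=
  FreeAlgebra.ι ℂ (YHGen.g i hi)

/-- The framing generator as an element of the free algebra. -/
def T {n : ℕ} (j : ℕ) (hj : j < n) : FreeAlgebra ℂ (YHGen n) :=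
  FreeAlgebra.ι ℂ (YHGen.t j hj)

end YHGen

open YHGen in
/-- The defining relations of the Yokonuma-Hecke algebra. -/
inductive YHRel (d : ℕ) (u : ℂ) (n : ℕ) :
    FreeAlgebra ℂ (YHGen n) → FreeAlgebra ℂ (YHGen n) → Prop
  | far (i j : ℕ) (hi : i + 1 < n) (hj : j + 1 < n) (hij : i + 1 < j ∨ j + 1 < i) :
      YHRel d u n (G i hi * G j hj) (G j hj * G i hi)
  | braid (i : ℕ) (hi : i + 2 < n) :
      YHRel d u n
        (G i (by omega) * G (i + 1) hi * G i (by omega))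
        (G (i + 1) hi * G i (by omega) * G (i + 1) hi)
  | frame_comm (i j : ℕ) (hi : i < n) (hj : j < n) :
      YHRel d u n (T i hi * T j hj) (T j hj * T i hi)
  | frame_braid (i j : ℕ) (hi : i + 1 < n) (hj : j < n) :
      YHRel d u n (T j hj * G i hi) (G i hi * T (Equiv.swap i (i + 1) j) (yh_swap_lt hi hj))
  | frame_pow (j : ℕ) (hj : j < n) :
      YHRel d u n (T j hj ^ d) 1
  | quadratic (i : ℕ) (hi : i + 1 < n) :
      YHRel d u n (G i hi ^ 2)
        (1 + (u - 1) • yhE d (T i (by omega)) (T (i + 1) hi)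
          + (u - 1) • (yhE d (T i (by omega)) (T (i + 1) hi) * G i hi))

/-- The Yokonuma-Hecke algebra `Y_{d,n}(u)`: the complex unital associative algebra with the
generators `YHGen n` and the relations `YHRel d u n`. -/
abbrev YH (d : ℕ) (u : ℂ) (n : ℕ) : Type := RingQuot (YHRel d u n)

namespace YH

variable (d : ℕ) (u : ℂ)

/-- The braiding generator `g_i` of `Y_{d,n}(u)`. -/
def g {n : ℕ} (i : ℕ) (hi : i + 1 < n) : YH d u n :=
  RingQuot.mkAlgHom ℂ (YHRel d u n) (YHGen.G i hi)

/-- The framing generator `t_j` of `Y_{d,n}(u)`. -/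
def t {n : ℕ} (j : ℕ) (hj : j < n) : YH d u n :=
  RingQuot.mkAlgHom ℂ (YHRel d u n) (YHGen.T j hj)

/-- The element `e_i` of `Y_{d,n}(u)`. -/
def e {n : ℕ} (i : ℕ) (hi : i + 1 < n) : YH d u n :=
  yhE d (t d u i (by omega)) (t d u (i + 1) hi)

theorem map_yhE {A B : Type*} [Ring A] [Algebra ℂ A] [Ring B] [Algebra ℂ B]
    (f : A →ₐ[ℂ] B) (a b : A) : f (yhE d a b) = yhE d (f a) (f b) := by
  simp [yhE]

variable {d u} in
theorem rel {n : ℕ} {a b : FreeAlgebra ℂ (YHGen n)} (h : YHRel d u n a b) :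
    RingQuot.mkAlgHom ℂ (YHRel d u n) a = RingQuot.mkAlgHom ℂ (YHRel d u n) b :=
  RingQuot.mkAlgHom_rel ℂ h

/-- The image of a generator on `n` strands among the elements of `Y_{d,n+1}(u)`. -/
def inclGen {n : ℕ} : YHGen n → YH d u (n + 1)
  | YHGen.g i hi => g d u i (by omega)
  | YHGen.t j hj => t d u j (by omega)

theorem inclGen_rel {n : ℕ} {a b : FreeAlgebra ℂ (YHGen n)} (h : YHRel d u n a b) :
    FreeAlgebra.lift ℂ (inclGen d u) a = FreeAlgebra.lift ℂ (inclGen d u) b := by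
  induction h with
  | far i j hi hj hij =>
    simpa [YHGen.G, inclGen, g] using
      rel (YHRel.far (d := d) (u := u) (n := n + 1) i j (by omega) (by omega) hij)
  | braid i hi =>
    simpa [YHGen.G, inclGen, g] using
      rel (YHRel.braid (d := d) (u := u) (n := n + 1) i (by omega))
  | frame_comm i j hi hj =>
    simpa [YHGen.T, inclGen, t] using
      rel (YHRel.frame_comm (d := d) (u := u) (n := n + 1) i j (by omega) (by omega))
  | frame_braid i j hi hj =>
    simpa [YHGen.T, YHGen.G, inclGen, t, g] using
      rel (YHRel.frame_braid (d := d) (u := u) (n := n + 1) i j (by omega) (by omega))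
  | frame_pow j hj =>
    simpa [YHGen.T, inclGen, t] using
      rel (YHRel.frame_pow (d := d) (u := u) (n := n + 1) j (by omega))
  | quadratic i hi =>
    simpa [YHGen.T, YHGen.G, inclGen, t, g, map_yhE] using
      rel (YHRel.quadratic (d := d) (u := u) (n := n + 1) i (by omega))

/-- The natural algebra homomorphism `Y_{d,n}(u) → Y_{d,n+1}(u)`, which sends each generator to
the generator with the same name. -/
def incl (n : ℕ) : YH d u n →ₐ[ℂ] YH d u (n + 1) :=
  RingQuot.liftAlgHom ℂ
    ⟨FreeAlgebra.lift ℂ (inclGen d u), fun _ _ h => inclGen_rel d u h⟩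

theorem incl_g {n : ℕ} (i : ℕ) (hi : i + 1 < n) :
    incl d u n (g d u i hi) = g d u i (by omega) := by
  simp [incl, g, YHGen.G, inclGen]

theorem incl_t {n : ℕ} (j : ℕ) (hj : j < n) :
    incl d u n (t d u j hj) = t d u j (by omega) := by
  simp [incl, t, YHGen.T, inclGen]

/-- The element `g_{i,i+1} = g_i g_{i+1} g_i + g_{i+1} g_i + g_i g_{i+1} + g_i + g_{i+1} + 1`. -/
def gg {n : ℕ} (i : ℕ) (hi : i + 2 < n) : YH d u n :=
  g d u i (by omega) * g d u (i + 1) hi * g d u i (by omega)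
    + g d u (i + 1) hi * g d u i (by omega)
    + g d u i (by omega) * g d u (i + 1) hi
    + g d u i (by omega) + g d u (i + 1) hi + 1

/-- The element `r_{i,i+1} = e_i e_{i+1} g_{i,i+1}`. -/
def r {n : ℕ} (i : ℕ) (hi : i + 2 < n) : YH d u n :=
  e d u i (by omega) * e d u (i + 1) hi * gg d u i hi

end YH

/-- The two-sided ideal of `Y_{d,n}(u)` generated by all the elements `r_{i,i+1}`. -/
def ftlIdeal (d : ℕ) (u : ℂ) (n : ℕ) : TwoSidedIdeal (YH d u n) :=
  TwoSidedIdeal.span {a | ∃ (i : ℕ) (hi : i + 2 < n), a = YH.r d u i hi}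

/-- The framization `FTL_{d,n}(u)` of the Temperley-Lieb algebra. -/
abbrev FTL (d : ℕ) (u : ℂ) (n : ℕ) : Type := (ftlIdeal d u n).ringCon.Quotient

/-- A linear functional on `Y_{d,n}(u)` passes to `FTL_{d,n}(u)` if it factors through the
quotient map. -/
def PassesToFTL {d : ℕ} {u : ℂ} {n : ℕ} (τ : YH d u n →ₗ[ℂ] ℂ) : Prop :=
  ∃ σ : FTL d u n →ₗ[ℂ] ℂ, ∀ a : YH d u n, σ ((ftlIdeal d u n).ringCon.mkₐ ℂ a) = τ a

/-- The defining rules of the Juyumaya trace with parameters `z` and `x_1, …, x_{d-1}`. A linear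
map on the inductive limit of the algebras `Y_{d,n}(u)` is given as a family of linear maps that is
compatible with the maps `Y_{d,n}(u) → Y_{d,n+1}(u)`. Because the indices start at `0`, the last
braiding generator of `Y_{d,n+2}(u)` is `g n` and the last framing generator of `Y_{d,n+1}(u)` is
`t n`. -/
structure IsJuyumayaTrace (d : ℕ) (u z : ℂ) (x : ZMod d → ℂ)
    (tr : ∀ n : ℕ, YH d u n →ₗ[ℂ] ℂ) : Prop where
  compat : ∀ (n : ℕ) (a : YH d u n), tr (n + 1) (YH.incl d u n a) = tr n a
  one : ∀ n : ℕ, tr n 1 = 1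
  comm : ∀ (n : ℕ) (a b : YH d u n), tr n (a * b) = tr n (b * a)
  markov : ∀ (n : ℕ) (a : YH d u (n + 1)),
    tr (n + 2) (YH.incl d u (n + 1) a * YH.g d u n (by omega)) = z * tr (n + 1) a
  frame : ∀ (n : ℕ) (a : YH d u n) (m : ℕ), 1 ≤ m → m ≤ d - 1 →
    tr (n + 1) (YH.incl d u n a * YH.t d u n (by omega) ^ m) = x (m : ZMod d) * tr n a

section Fourier

variable {d : ℕ} [NeZero d]

/-- The support of the Fourier transform `y_k = ∑_m x_m exp(-km)`, with
`exp(j) = e^{2πij/d}`, of a function on `ℤ/dℤ`. -/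
def ftSupport (x : ZMod d → ℂ) : Finset (ZMod d) :=
  {k | ZMod.dft x k ≠ 0}

open Classical in
/-- The set of those `k` in the support where `y_k = -dz`. -/
def ftD₁ (z : ℂ) (x : ZMod d → ℂ) : Finset (ZMod d) :=
  {k ∈ ftSupport x | ZMod.dft x k = -(d : ℂ) * z}

open Classical in
/-- The set of those `k` in the support where `y_k = -dz(u+1)`. -/
def ftD₂ (u z : ℂ) (x : ZMod d → ℂ) : Finset (ZMod d) :=
  {k ∈ ftSupport x | ZMod.dft x k = -(d : ℂ) * z * (u + 1)}

end Fourier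

end

/-! The quotient imposes one polynomial equation on each Fourier coefficient of `x`. If `t ^ d = 1`,
the spectral idempotents `E_k(t)` (`eigenIdem`) diagonalise the framing: `e_i = ∑_k E_k(t_i)
E_k(t_{i+1})` (`yhE_eq_sum`), and the trace of `ι(a) E_k(t_n)` is `w_k tr(a)` with `w_k = y_k / d`
(`frameWeight`).

By cyclicity the trace passes to the quotient exactly when `tr(b r_{i,i+1}) = 0` for all `b` and
`i`. Conjugation by `g_i g_{i+1} g_{i+2}`, invertible because `u ≠ 0`, reduces this to `i = 0`, and
the Markov rules reduce it to `n = 3`. There `r_{0,1}` is the sum over `k` of `r_k = E_k(t_0)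
E_k(t_1) E_k(t_2) g_{0,1}`, and each `r_k` is a common eigenvector for left multiplication: the
`g_i` act by `u` and the `t_j` by `exp(k)`. So only the numbers `tr(r_k) = w_k (w_k + z) (w_k +
(u+1) z)` matter (`map_rIdem`), and each of them must vanish because `r_k = E_k(t_0) r_{0,1}`. Thus
every `w_k` is `0`, `-z` or `-(u+1)z`. Fourier inversion turns this into the formula for `x_m`; the
normalisation `x_0 = 1` excludes `z = 0` and determines `z` (`frameWeight_condition_iff`).

Most of the work is the existence and uniqueness of the trace. Uniqueness follows from
`decomposition`: `Y_{d,n+1}` is the sum of the `ι(Y_{d,n}) E_k(t_n)` and `ι(Y_{d,n}) g_{n-1}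
ι(Y_{d,n})`. For existence, the left ideal generated by `E_k(t_n)` is modelled by columns of
coefficients in `Y_{d,n}` with an explicit action (`rep`), so no basis theorem is needed. Evaluating
these columns gives a bimodule map `condExp` from `Y_{d,n+1}` to `Y_{d,n}` with `E_k(t_n) ↦ w_k` and
`g_{n-1} ↦ z`, and the trace is the composite of these maps. In the proof of `tr(ab) = tr(ba)` the
one hard case says that `a ↦ E(g a g)` is self-adjoint for the trace form (`jtrace_mul_conjExp`). -/

/-! ### Spectral idempotents of an element of order dividing `d`. -/

section Idempotents

set_option linter.unusedSectionVars false

variable {d : ℕ} [NeZero d] {A : Type*} [Ring A] [Algebra ℂ A]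

theorem pow_val_add {a : A} (ha : a ^ d = 1) (m l : ZMod d) :
    a ^ (m + l).val = a ^ m.val * a ^ l.val := by
  rw [ZMod.val_add, ← pow_add]
  exact (pow_eq_pow_mod _ ha).symm

theorem pow_val_natCast {a : A} (ha : a ^ d = 1) (s : ℕ) :
    a ^ (s : ZMod d).val = a ^ s := by
  rw [ZMod.val_natCast]
  exact (pow_eq_pow_mod _ ha).symm

theorem sum_range_natCast {M : Type*} [AddCommMonoid M] (f : ZMod d → M) :
    ∑ s ∈ Finset.range d, f (s : ZMod d) = ∑ m : ZMod d, f m := by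
  refine Finset.sum_bij' (fun s _ => (s : ZMod d)) (fun m _ => m.val) ?_ ?_ ?_ ?_ ?_
  · intros; simp
  · intro m _; simpa using ZMod.val_lt m
  · intro s hs; simpa using ZMod.val_cast_of_lt (by simpa using hs)
  · intro m _; simp
  · intros; rfl

theorem sum_stdAddChar_mul (b : ZMod d) :
    ∑ m : ZMod d, (ZMod.stdAddChar (m * b) : ℂ) = if b = 0 then (d : ℂ) else 0 := by
  rw [AddChar.sum_mulShift b (ZMod.isPrimitive_stdAddChar d)]
  split_ifs <;> simp [ZMod.card]

theorem stdAddChar_mul_natCast (k : ZMod d) (s : ℕ) :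
    (ZMod.stdAddChar (k * (s : ZMod d)) : ℂ) = ZMod.stdAddChar k ^ s := by
  rw [← AddChar.map_nsmul_eq_pow, nsmul_eq_mul, mul_comm]

theorem stdAddChar_pow_card (k : ZMod d) : (ZMod.stdAddChar k : ℂ) ^ d = 1 := by
  rw [← stdAddChar_mul_natCast]; simp

theorem natCast_card_ne_zero : (d : ℂ) ≠ 0 := Nat.cast_ne_zero.mpr (NeZero.ne d)

/-- For `a ^ d = 1`, the idempotent that projects to the eigenspace of `a` for `exp(k)`. -/
noncomputable def eigenIdem (k : ZMod d) (a : A) : A :=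
  (1 / (d : ℂ)) • ∑ m : ZMod d, (ZMod.stdAddChar (-(m * k)) : ℂ) • a ^ m.val

theorem map_eigenIdem {B : Type*} [Ring B] [Algebra ℂ B] (f : A →ₐ[ℂ] B) (k : ZMod d) (a : A) :
    f (eigenIdem k a) = eigenIdem k (f a) := by
  simp [eigenIdem]

theorem eigenIdem_semiconj {a b c : A} (h : c * a = b * c) (k : ZMod d) :
    c * eigenIdem k a = eigenIdem k b * c := by
  have h' : SemiconjBy c a b := h
  simp only [eigenIdem, mul_smul_comm, Finset.mul_sum, smul_mul_assoc, Finset.sum_mul]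
  simp only [(h'.pow_right _).eq]

theorem eigenIdem_commute {a b : A} (h : Commute a b) (k l : ZMod d) :
    Commute (eigenIdem k a) (eigenIdem l b) :=
  eigenIdem_semiconj (eigenIdem_semiconj h.symm k).symm l

theorem mul_eigenIdem {a : A} (ha : a ^ d = 1) (k : ZMod d) :
    a * eigenIdem k a = (ZMod.stdAddChar k : ℂ) • eigenIdem k a := by
  simp only [eigenIdem, mul_smul_comm, Finset.mul_sum]
  rw [smul_comm]
  congr 1
  rw [Finset.smul_sum]
  -- Multiplication by `a` shifts the exponent, so the sum is reindexed by `m ↦ m + 1` in `ZMod d`.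
  refine Fintype.sum_equiv (Equiv.addRight 1) _ _ fun m => ?_
  simp only [Equiv.coe_addRight]
  rw [pow_val_add ha, smul_smul, ← AddChar.map_add_eq_mul]
  have h1 : a ^ (1 : ZMod d).val = a := by simpa using pow_val_natCast ha 1
  rw [h1, ← pow_succ, pow_succ']
  congr 2
  ring

theorem pow_mul_eigenIdem {a : A} (ha : a ^ d = 1) (k : ZMod d) (s : ℕ) :
    a ^ s * eigenIdem k a = (ZMod.stdAddChar (k * (s : ZMod d)) : ℂ) • eigenIdem k a := by
  induction s with
  | zero => simp
  | succ s ih =>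
    rw [pow_succ', mul_assoc, ih, mul_smul_comm, mul_eigenIdem ha, smul_smul,
      ← AddChar.map_add_eq_mul]
    congr 2
    push_cast; ring

/-- On the right factor `a` acts as `exp(l)`, so the left factor becomes the scalar `(1/d) ∑_m
exp(m(l - k))`, and characters are orthogonal. -/
theorem eigenIdem_mul_eigenIdem {a : A} (ha : a ^ d = 1) (k l : ZMod d) :
    eigenIdem k a * eigenIdem l a = if k = l then eigenIdem k a else 0 := by
  have : eigenIdem k a * eigenIdem l a
      = ((1 / (d : ℂ)) * ∑ m : ZMod d, (ZMod.stdAddChar (m * (l - k)) : ℂ)) • eigenIdem l a := by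
    conv_lhs => rw [eigenIdem]
    rw [smul_mul_assoc, Finset.sum_mul, mul_smul, Finset.sum_smul]
    congr 1
    refine Finset.sum_congr rfl fun m _ => ?_
    rw [smul_mul_assoc, pow_mul_eigenIdem ha, smul_smul, ← AddChar.map_add_eq_mul]
    congr 2
    simp; ring
  rw [this, sum_stdAddChar_mul]
  have hd := natCast_card_ne_zero (d := d)
  by_cases h : k = l
  · subst h; simp [hd]
  · have : l - k ≠ 0 := sub_ne_zero.mpr (Ne.symm h)
    simp [h, this]

theorem eigenIdem_idem {a : A} (ha : a ^ d = 1) (k : ZMod d) :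
    eigenIdem k a * eigenIdem k a = eigenIdem k a := by
  simp [eigenIdem_mul_eigenIdem ha]

theorem sum_eigenIdem {a : A} : ∑ k : ZMod d, eigenIdem k a = 1 := by
  have hd := natCast_card_ne_zero (d := d)
  simp only [eigenIdem]
  rw [← Finset.smul_sum, Finset.sum_comm]
  have : ∀ m : ZMod d, ∑ k : ZMod d, (ZMod.stdAddChar (-(m * k)) : ℂ) • a ^ m.val
      = if m = 0 then (d : ℂ) • (1 : A) else 0 := by
    intro m
    rw [← Finset.sum_smul]
    have := sum_stdAddChar_mul (-m)
    simp only [mul_neg, mul_comm _ m] at this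
    rw [this]
    by_cases h : m = 0 <;> simp [h]
  simp [this, smul_smul, hd]

theorem pow_eq_sum_eigenIdem {a : A} (ha : a ^ d = 1) (s : ℕ) :
    a ^ s = ∑ k : ZMod d, (ZMod.stdAddChar (k * (s : ZMod d)) : ℂ) • eigenIdem k a := by
  conv_lhs => rw [← mul_one (a ^ s), ← sum_eigenIdem (d := d) (a := a), Finset.mul_sum]
  simp only [pow_mul_eigenIdem ha]

/-- Since `b ^ d = 1`, the exponent `d - s` acts as `-s`. The term for the characters `k`, `l` thus
carries `exp(s(k - l))`, and the sum over `s` leaves only `k = l`. -/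
theorem yhE_eq_sum {a b : A} (ha : a ^ d = 1) (hb : b ^ d = 1) :
    yhE d a b = ∑ k : ZMod d, eigenIdem k a * eigenIdem k b := by
  have hd := natCast_card_ne_zero (d := d)
  have h1 : ∀ s ∈ Finset.range d, a ^ s * b ^ (d - s)
      = ∑ k : ZMod d, ∑ l : ZMod d,
        (ZMod.stdAddChar ((s : ZMod d) * (k - l)) : ℂ) • (eigenIdem k a * eigenIdem l b) := by
    intro s hs
    rw [pow_eq_sum_eigenIdem ha, pow_eq_sum_eigenIdem hb, Finset.sum_mul_sum]
    refine Finset.sum_congr rfl fun k _ => Finset.sum_congr rfl fun l _ => ?_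
    rw [smul_mul_smul_comm, ← AddChar.map_add_eq_mul, Nat.cast_sub (Finset.mem_range.mp hs).le]
    congr 2
    simp; ring
  rw [yhE, Finset.sum_congr rfl h1,
    sum_range_natCast (fun s : ZMod d => ∑ k : ZMod d, ∑ l : ZMod d,
        (ZMod.stdAddChar (s * (k - l)) : ℂ) • (eigenIdem k a * eigenIdem l b)),
    Finset.sum_comm, Finset.smul_sum]
  refine Finset.sum_congr rfl fun k _ => ?_
  rw [Finset.sum_comm]
  simp only [← Finset.sum_smul, sum_stdAddChar_mul, sub_eq_zero]
  simp [smul_smul, hd]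

theorem eigenIdem_mul_yhE {a b : A} (ha : a ^ d = 1) (hb : b ^ d = 1) (k : ZMod d) :
    eigenIdem k a * yhE d a b = eigenIdem k a * eigenIdem k b := by
  rw [yhE_eq_sum ha hb, Finset.mul_sum]
  simp [← mul_assoc, eigenIdem_mul_eigenIdem ha]

theorem eigenIdem_smul_one (k l : ZMod d) :
    eigenIdem k ((ZMod.stdAddChar l : ℂ) • (1 : A)) = if k = l then 1 else 0 := by
  have hd := natCast_card_ne_zero (d := d)
  have h1 : ∀ m : ZMod d, (ZMod.stdAddChar (-(m * k)) : ℂ) •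
      ((ZMod.stdAddChar l : ℂ) • (1 : A)) ^ m.val
      = (ZMod.stdAddChar (m * (l - k)) : ℂ) • (1 : A) := by
    intro m
    rw [smul_pow, one_pow, smul_smul, ← stdAddChar_mul_natCast, ← AddChar.map_add_eq_mul]
    congr 2
    simp; ring
  rw [eigenIdem, Finset.sum_congr rfl fun m _ => h1 m, ← Finset.sum_smul, sum_stdAddChar_mul]
  by_cases h : k = l
  · subst h; simp [hd]
  · have : l - k ≠ 0 := sub_ne_zero.mpr (Ne.symm h)
    simp [h, this]

theorem smul_one_pow_card (k : ZMod d) :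
    ((ZMod.stdAddChar k : ℂ) • (1 : A)) ^ d = 1 := by
  rw [smul_pow, one_pow, stdAddChar_pow_card, one_smul]

/-- Needed in the induced representation, where one of the two framing generators in `e_i` acts on a
coordinate by a scalar. -/
theorem yhE_smul_one_left {b : A} (hb : b ^ d = 1) (k : ZMod d) :
    yhE d ((ZMod.stdAddChar k : ℂ) • (1 : A)) b = eigenIdem k b := by
  rw [yhE_eq_sum (smul_one_pow_card k) hb]
  simp [eigenIdem_smul_one]

theorem yhE_smul_one_right {b : A} (hb : b ^ d = 1) (k : ZMod d) :
    yhE d b ((ZMod.stdAddChar k : ℂ) • (1 : A)) = eigenIdem k b := by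
  rw [yhE_eq_sum hb (smul_one_pow_card k)]
  simp [eigenIdem_smul_one]

theorem yhE_one_one : yhE d (1 : A) 1 = 1 := by
  simp [yhE, ← Nat.cast_smul_eq_nsmul ℂ, smul_smul, natCast_card_ne_zero (d := d)]

end Idempotents

/-! ### Relations between generators and idempotents in the Yokonuma-Hecke algebra. -/

section Generators

set_option linter.unusedSectionVars false

variable {d : ℕ} {u : ℂ} {n : ℕ}

namespace YH

/-- The framing generator `t_j`, extended by `1` to all indices. -/
noncomputable def tt (d : ℕ) (u : ℂ) (n j : ℕ) : YH d u n :=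
  if h : j < n then t d u j h else 1

/-- The braiding generator `g_i`, extended by `0` to all indices. -/
noncomputable def gt (d : ℕ) (u : ℂ) (n i : ℕ) : YH d u n :=
  if h : i + 1 < n then g d u i h else 0

theorem t_eq_tt {j : ℕ} (h : j < n) : t d u j h = tt d u n j := by simp [tt, h]

theorem g_eq_gt {i : ℕ} (h : i + 1 < n) : g d u i h = gt d u n i := by simp [gt, h]

theorem gt_of_le {i : ℕ} (h : n ≤ i + 1) : gt d u n i = 0 := by simp [gt, h]

theorem tt_pow (j : ℕ) : tt d u n j ^ d = 1 := by
  by_cases h : j < n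
  · simpa [tt, h, t] using rel (YHRel.frame_pow (d := d) (u := u) j h)
  · simp [tt, h]

theorem tt_comm (i j : ℕ) : tt d u n i * tt d u n j = tt d u n j * tt d u n i := by
  by_cases hi : i < n
  · by_cases hj : j < n
    · simpa [tt, hi, hj, t] using rel (YHRel.frame_comm (d := d) (u := u) i j hi hj)
    · simp [tt, hj]
  · simp [tt, hi]

theorem gt_far {i j : ℕ} (h : i + 1 < j) : gt d u n i * gt d u n j = gt d u n j * gt d u n i := by
  by_cases hj : j + 1 < n
  · have hi : i + 1 < n := by omega
    simpa [gt, hi, hj, g] using rel (YHRel.far (d := d) (u := u) i j hi hj (Or.inl h))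
  · simp [gt, hj]

theorem gt_braid (i : ℕ) :
    gt d u n i * gt d u n (i + 1) * gt d u n i
      = gt d u n (i + 1) * gt d u n i * gt d u n (i + 1) := by
  by_cases h : i + 2 < n
  · have hi : i + 1 < n := by omega
    simpa [gt, hi, h, g] using rel (YHRel.braid (d := d) (u := u) i h)
  · rw [gt_of_le (i := i + 1) (by omega)]; simp

theorem tt_mul_gt (i j : ℕ) :
    tt d u n j * gt d u n i = gt d u n i * tt d u n (Equiv.swap i (i + 1) j) := by
  by_cases hi : i + 1 < n
  · by_cases hj : j < n
    · have hj' := yh_swap_lt hi hj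
      simpa [gt, tt, hi, hj, hj', g, t] using rel (YHRel.frame_braid (d := d) (u := u) i j hi hj)
    · have : Equiv.swap i (i + 1) j = j := Equiv.swap_apply_of_ne_of_ne (by omega) (by omega)
      simp [tt, this, hj]
  · simp [gt, hi]

theorem tt_mul_gt_same (i : ℕ) : tt d u n i * gt d u n i = gt d u n i * tt d u n (i + 1) := by
  simp [tt_mul_gt]

theorem tt_succ_mul_gt (i : ℕ) : tt d u n (i + 1) * gt d u n i = gt d u n i * tt d u n i := by
  simp [tt_mul_gt]

theorem tt_mul_gt_of_ne {i j : ℕ} (h : j ≠ i) (h' : j ≠ i + 1) :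
    tt d u n j * gt d u n i = gt d u n i * tt d u n j := by
  rw [tt_mul_gt, Equiv.swap_apply_of_ne_of_ne h h']

/-- The default values `1` for `tt` and `0` for `gt` satisfy every other relation without bounds;
only this one fails for `gt = 0`. -/
theorem gt_sq {i : ℕ} (h : i + 1 < n) :
    gt d u n i * gt d u n i = 1 + (u - 1) • yhE d (tt d u n i) (tt d u n (i + 1))
      + (u - 1) • (yhE d (tt d u n i) (tt d u n (i + 1)) * gt d u n i) := by
  have hi : i < n := by omega
  have := rel (YHRel.quadratic (d := d) (u := u) i h)
  simpa [gt, tt, h, hi, g, t, pow_two, map_yhE] using this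

theorem induction {P : YH d u n → Prop} (hc : ∀ c : ℂ, P (algebraMap ℂ _ c))
    (hadd : ∀ a b, P a → P b → P (a + b)) (hmul : ∀ a b, P a → P b → P (a * b))
    (hg : ∀ i, i + 1 < n → P (gt d u n i)) (ht : ∀ j, j < n → P (tt d u n j)) (a : YH d u n) :
    P a := by
  obtain ⟨b, rfl⟩ := RingQuot.mkAlgHom_surjective ℂ (YHRel d u n) a
  induction b using FreeAlgebra.induction with
  | grade0 c => simpa using hc c
  | grade1 x =>
    cases x with
    | g i hi => have := hg i hi; rwa [← g_eq_gt hi] at this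
    | t j hj => have := ht j hj; rwa [← t_eq_tt hj] at this
  | mul a b ha hb => simpa using hmul _ _ ha hb
  | add a b ha hb => simpa using hadd _ _ ha hb

theorem incl_gt {i : ℕ} (h : i + 1 < n) : incl d u n (gt d u n i) = gt d u (n + 1) i := by
  rw [← g_eq_gt h, incl_g, g_eq_gt]

theorem incl_tt {j : ℕ} (h : j < n) : incl d u n (tt d u n j) = tt d u (n + 1) j := by
  rw [← t_eq_tt h, incl_t, t_eq_tt]

theorem incl_mul_tt (a : YH d u n) :
    incl d u n a * tt d u (n + 1) n = tt d u (n + 1) n * incl d u n a := by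
  induction a using induction with
  | hc c => simp [Algebra.commutes]
  | hadd a b ha hb => rw [map_add, add_mul, mul_add, ha, hb]
  | hmul a b ha hb => rw [map_mul, mul_assoc, hb, ← mul_assoc, ha, mul_assoc]
  | hg i hi => rw [incl_gt hi, tt_mul_gt_of_ne (by omega) (by omega)]
  | ht j hj => rw [incl_tt hj, tt_comm]

theorem incl_incl_mul_gt (a : YH d u n) :
    incl d u (n + 1) (incl d u n a) * gt d u (n + 2) n
      = gt d u (n + 2) n * incl d u (n + 1) (incl d u n a) := by
  induction a using induction with
  | hc c => simp [Algebra.commutes]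
  | hadd a b ha hb => rw [map_add, map_add, add_mul, mul_add, ha, hb]
  | hmul a b ha hb => rw [map_mul, map_mul, mul_assoc, hb, ← mul_assoc, ha, mul_assoc]
  | hg i hi => rw [incl_gt hi, incl_gt (by omega), gt_far (by omega)]
  | ht j hj => rw [incl_tt hj, incl_tt (by omega), tt_mul_gt_of_ne (by omega) (by omega)]

variable [NeZero d]

/-- The idempotent of `t_j` for the character `k`. -/
noncomputable def idem (d : ℕ) [NeZero d] (u : ℂ) (n : ℕ) (k : ZMod d) (j : ℕ) : YH d u n :=
  eigenIdem k (tt d u n j)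

theorem idem_mul_idem (k l : ZMod d) (j : ℕ) :
    idem d u n k j * idem d u n l j = if k = l then idem d u n k j else 0 :=
  eigenIdem_mul_eigenIdem (tt_pow j) k l

theorem idem_mul_self (k : ZMod d) (j : ℕ) :
    idem d u n k j * idem d u n k j = idem d u n k j :=
  eigenIdem_idem (tt_pow j) k

theorem sum_idem (j : ℕ) : ∑ k : ZMod d, idem d u n k j = 1 := sum_eigenIdem

theorem idem_comm (k l : ZMod d) (i j : ℕ) :
    idem d u n k i * idem d u n l j = idem d u n l j * idem d u n k i :=
  eigenIdem_commute (tt_comm i j) k l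

theorem tt_mul_idem (k : ZMod d) (i j : ℕ) :
    tt d u n j * idem d u n k i = idem d u n k i * tt d u n j :=
  eigenIdem_semiconj (tt_comm _ _) k

theorem tt_mul_idem_same (k : ZMod d) (j : ℕ) :
    tt d u n j * idem d u n k j = (ZMod.stdAddChar k : ℂ) • idem d u n k j :=
  mul_eigenIdem (tt_pow j) k

theorem gt_mul_idem_same (k : ZMod d) (i : ℕ) :
    gt d u n i * idem d u n k i = idem d u n k (i + 1) * gt d u n i :=
  eigenIdem_semiconj (tt_succ_mul_gt i).symm k

theorem gt_mul_idem_succ (k : ZMod d) (i : ℕ) :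
    gt d u n i * idem d u n k (i + 1) = idem d u n k i * gt d u n i :=
  eigenIdem_semiconj (tt_mul_gt_same i).symm k

theorem gt_mul_idem_of_ne (k : ZMod d) {i j : ℕ} (h : j ≠ i) (h' : j ≠ i + 1) :
    gt d u n i * idem d u n k j = idem d u n k j * gt d u n i :=
  eigenIdem_semiconj (tt_mul_gt_of_ne h h').symm k

/-- The element `e_i` for all indices. -/
noncomputable def ee (d : ℕ) (u : ℂ) (n i : ℕ) : YH d u n :=
  yhE d (tt d u n i) (tt d u n (i + 1))

theorem ee_eq_sum (i : ℕ) :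
    ee d u n i = ∑ k : ZMod d, idem d u n k i * idem d u n k (i + 1) :=
  yhE_eq_sum (tt_pow _) (tt_pow _)

theorem idem_mul_ee (k : ZMod d) (i : ℕ) :
    idem d u n k i * ee d u n i = idem d u n k i * idem d u n k (i + 1) :=
  eigenIdem_mul_yhE (tt_pow _) (tt_pow _) k

theorem gt_mul_ee (i : ℕ) : gt d u n i * ee d u n i = ee d u n i * gt d u n i := by
  rw [ee_eq_sum, Finset.mul_sum, Finset.sum_mul]
  refine Finset.sum_congr rfl fun k _ => ?_
  rw [← mul_assoc, gt_mul_idem_same, mul_assoc, gt_mul_idem_succ, ← mul_assoc, idem_comm]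

theorem ee_mul_self (i : ℕ) : ee d u n i * ee d u n i = ee d u n i := by
  nth_rw 1 [ee_eq_sum]
  rw [ee_eq_sum, Finset.sum_mul]
  refine Finset.sum_congr rfl fun k _ => ?_
  rw [idem_comm, mul_assoc, ← ee_eq_sum, idem_mul_ee, idem_comm, ← mul_assoc, idem_mul_self]

theorem gt_sq' {i : ℕ} (h : i + 1 < n) :
    gt d u n i * gt d u n i = 1 + (u - 1) • ee d u n i + (u - 1) • (ee d u n i * gt d u n i) :=
  gt_sq h

theorem idem_mul_gt_sq (k : ZMod d) {i : ℕ} (h : i + 1 < n) :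
    idem d u n k i * (gt d u n i * gt d u n i)
      = idem d u n k i + (u - 1) • (idem d u n k i * idem d u n k (i + 1))
        + (u - 1) • (idem d u n k i * idem d u n k (i + 1) * gt d u n i) := by
  rw [gt_sq' h]
  simp only [mul_add, mul_one, mul_smul_comm, ← mul_assoc, idem_mul_ee]

theorem incl_idem (k : ZMod d) {j : ℕ} (h : j < n) :
    incl d u n (idem d u n k j) = idem d u (n + 1) k j := by
  rw [idem, map_eigenIdem, incl_tt h, idem]

theorem incl_ee {i : ℕ} (h : i + 1 < n) : incl d u n (ee d u n i) = ee d u (n + 1) i := by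
  rw [ee, map_yhE, incl_tt (by omega), incl_tt h, ee]

theorem incl_mul_idem (a : YH d u n) (k : ZMod d) :
    incl d u n a * idem d u (n + 1) k n = idem d u (n + 1) k n * incl d u n a :=
  eigenIdem_semiconj (incl_mul_tt a) k

/-- Moving the idempotent to the right gives `g_i² E_k(t_{i+1})`. The last term is written with
`E_k(t_i)` on both sides of `g_i`, so that for the top generator both outer factors come from the
smaller algebra. -/
theorem gt_mul_idem_mul_gt (k : ZMod d) {i : ℕ} (h : i + 1 < n) :
    gt d u n i * idem d u n k i * gt d u n i
      = idem d u n k (i + 1) + (u - 1) • (idem d u n k i * idem d u n k (i + 1))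
        + (u - 1) • (idem d u n k i * gt d u n i * idem d u n k i) := by
  have h2 : gt d u n i * idem d u n k i * gt d u n i
      = gt d u n i * gt d u n i * idem d u n k (i + 1) := by
    rw [mul_assoc, mul_assoc, gt_mul_idem_succ]
  have h3 : idem d u n k i * ee d u n i = ee d u n i * idem d u n k (i + 1) := by
    rw [idem_mul_ee, ee_eq_sum, Finset.sum_mul]
    simp [mul_assoc, idem_mul_idem]
  have h4 : ee d u n i * gt d u n i * idem d u n k (i + 1)
      = idem d u n k i * gt d u n i * idem d u n k i := by
    rw [← gt_mul_ee, mul_assoc, ← h3, idem_mul_ee, idem_comm, ← mul_assoc, gt_mul_idem_succ]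
  rw [h2, gt_sq' h, add_mul, add_mul, one_mul, smul_mul_assoc, smul_mul_assoc, h4, ← h3,
    idem_mul_ee]

/-! ### Decomposition of `Y_{d,n+1}(u)` as a bimodule over `Y_{d,n}(u)`. -/

/-- The sums of elements `ι(b) E_k(t_n)` and `ι(b) g_{n-1} ι(c)` in `Y_{d,n+1}(u)`. -/
def bimoduleSpan (d : ℕ) [NeZero d] (u : ℂ) (n : ℕ) : AddSubmonoid (YH d u (n + 1)) :=
  AddSubmonoid.closure
    ({x | ∃ b k, x = incl d u n b * idem d u (n + 1) k n} ∪
      {x | ∃ m, m + 1 = n ∧ ∃ b c, x = incl d u n b * gt d u (n + 1) m * incl d u n c})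

theorem incl_mul_idem_mem (b : YH d u n) (k : ZMod d) :
    incl d u n b * idem d u (n + 1) k n ∈ bimoduleSpan d u n :=
  AddSubmonoid.subset_closure (Or.inl ⟨b, k, rfl⟩)

theorem incl_mul_gt_mul_incl_mem {m : ℕ} (h : m + 1 = n) (b c : YH d u n) :
    incl d u n b * gt d u (n + 1) m * incl d u n c ∈ bimoduleSpan d u n :=
  AddSubmonoid.subset_closure (Or.inr ⟨m, h, b, c, rfl⟩)

theorem incl_mul_mem (a : YH d u n) {p : YH d u (n + 1)} (hp : p ∈ bimoduleSpan d u n) :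
    incl d u n a * p ∈ bimoduleSpan d u n := by
  induction hp using AddSubmonoid.closure_induction with
  | mem x hx =>
    rcases hx with ⟨b, k, rfl⟩ | ⟨m, h, b, c, rfl⟩
    · rw [← mul_assoc, ← map_mul]; exact incl_mul_idem_mem _ _
    · rw [← mul_assoc, ← mul_assoc, ← map_mul]; exact incl_mul_gt_mul_incl_mem h _ _
  | zero => simp
  | add x y _ _ hx hy => rw [mul_add]; exact add_mem hx hy

theorem mul_incl_mem (a : YH d u n) {p : YH d u (n + 1)} (hp : p ∈ bimoduleSpan d u n) :
    p * incl d u n a ∈ bimoduleSpan d u n := by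
  induction hp using AddSubmonoid.closure_induction with
  | mem x hx =>
    rcases hx with ⟨b, k, rfl⟩ | ⟨m, h, b, c, rfl⟩
    · rw [mul_assoc, ← incl_mul_idem, ← mul_assoc, ← map_mul]; exact incl_mul_idem_mem _ _
    · rw [mul_assoc, ← map_mul]; exact incl_mul_gt_mul_incl_mem h _ _
  | zero => simp
  | add x y _ _ hx hy => rw [add_mul]; exact add_mem hx hy

theorem smul_mem_bimoduleSpan (c : ℂ) {p : YH d u (n + 1)} (hp : p ∈ bimoduleSpan d u n) :
    c • p ∈ bimoduleSpan d u n := by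
  have := incl_mul_mem (algebraMap ℂ _ c) hp
  rwa [AlgHom.commutes, ← Algebra.smul_def] at this

theorem one_mem_bimoduleSpan : 1 ∈ bimoduleSpan d u n := by
  rw [← sum_idem (d := d) (n := n + 1) (u := u) n]
  refine sum_mem fun k _ => ?_
  simpa using incl_mul_idem_mem (n := n) (u := u) 1 k

theorem tt_mul_mem {p : YH d u (n + 1)} (hp : p ∈ bimoduleSpan d u n) :
    tt d u (n + 1) n * p ∈ bimoduleSpan d u n := by
  induction hp using AddSubmonoid.closure_induction with
  | mem x hx =>
    rcases hx with ⟨b, k, rfl⟩ | ⟨m, rfl, b, c, rfl⟩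
    · rw [← mul_assoc, ← incl_mul_tt, mul_assoc, tt_mul_idem_same, mul_smul_comm]
      exact smul_mem_bimoduleSpan _ (incl_mul_idem_mem _ _)
    · rw [← mul_assoc, ← mul_assoc, ← incl_mul_tt, mul_assoc (incl _ _ _ _), tt_succ_mul_gt,
        ← incl_tt (by omega), ← mul_assoc, mul_assoc, ← map_mul]
      exact incl_mul_gt_mul_incl_mem rfl _ _
  | zero => simp
  | add x y _ _ hx hy => rw [mul_add]; exact add_mem hx hy

theorem gt_mul_mem {m : ℕ} (h : m + 1 = n)
    (key : ∀ b, gt d u (n + 1) m * incl d u n b * gt d u (n + 1) m ∈ bimoduleSpan d u n)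
    {p : YH d u (n + 1)} (hp : p ∈ bimoduleSpan d u n) :
    gt d u (n + 1) m * p ∈ bimoduleSpan d u n := by
  induction hp using AddSubmonoid.closure_induction with
  | mem x hx =>
    rcases hx with ⟨b, k, rfl⟩ | ⟨m', h', b, c, rfl⟩
    · subst h
      rw [incl_mul_idem, ← mul_assoc, gt_mul_idem_succ, ← incl_idem _ (by omega)]
      exact incl_mul_gt_mul_incl_mem rfl _ _
    · obtain rfl : m' = m := by omega
      rw [← mul_assoc, ← mul_assoc]
      exact mul_incl_mem _ (key b)
  | zero => simp
  | add x y _ _ hx hy => rw [mul_add]; exact add_mem hx hy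

/-- The span contains `1` and is stable under left multiplication by `ι(Y_{d,n})` and `t_n`. The
hypothesis supplies stability under the remaining generator `g_{n-1}`. -/
theorem bimoduleSpan_eq_top_of_key
    (key : ∀ m, m + 1 = n → ∀ b,
      gt d u (n + 1) m * incl d u n b * gt d u (n + 1) m ∈ bimoduleSpan d u n)
    (a : YH d u (n + 1)) : a ∈ bimoduleSpan d u n := by
  suffices ∀ p ∈ bimoduleSpan d u n, a * p ∈ bimoduleSpan d u n by
    simpa using this 1 one_mem_bimoduleSpan
  induction a using induction with
  | hc c => intro p hp; rw [← Algebra.smul_def]; exact smul_mem_bimoduleSpan c hp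
  | hadd a b ha hb => intro p hp; rw [add_mul]; exact add_mem (ha p hp) (hb p hp)
  | hmul a b ha hb => intro p hp; rw [mul_assoc]; exact ha _ (hb p hp)
  | hg i hi =>
    intro p hp
    by_cases h : i + 1 < n
    · rw [← incl_gt h]; exact incl_mul_mem _ hp
    · have h' : i + 1 = n := by omega
      exact gt_mul_mem h' (key i h') hp
  | ht j hj =>
    intro p hp
    by_cases h : j < n
    · rw [← incl_tt h]; exact incl_mul_mem _ hp
    · obtain rfl : j = n := by omega
      exact tt_mul_mem hp

/-- Used with `g` the top generator, `h` the one below it, and `b`, `c` from two levels down: it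
leaves a single `g`. -/
theorem braid_sandwich {A : Type*} [Ring A] {g h b c : A} (hb : b * g = g * b)
    (hc : c * g = g * c) (hgh : g * h * g = h * g * h) :
    g * (b * h * c) * g = b * h * g * (h * c) := by
  calc g * (b * h * c) * g = (g * b) * h * (c * g) := by simp only [mul_assoc]
    _ = b * (g * h * g) * c := by rw [← hb, hc]; simp only [mul_assoc]
    _ = b * h * g * (h * c) := by rw [hgh]; simp only [mul_assoc]

/-- It remains to place `g ι(b) g` in the span. Decompose `b` one level down: a summand with `E_k`
is handled by `gt_mul_idem_mul_gt`, a summand with the lower braiding generator by the braid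
relation. -/
theorem mem_bimoduleSpan : ∀ {n : ℕ} (a : YH d u (n + 1)), a ∈ bimoduleSpan d u n := by
  intro n
  induction n with
  | zero => exact bimoduleSpan_eq_top_of_key (by omega)
  | succ n ih =>
    refine bimoduleSpan_eq_top_of_key fun m hm b => ?_
    obtain rfl : m = n := by omega
    induction ih b using AddSubmonoid.closure_induction with
    | mem x hx =>
      rcases hx with ⟨b, k, rfl⟩ | ⟨m', rfl, b, c, rfl⟩
      · rw [map_mul, ← mul_assoc, ← incl_incl_mul_gt, incl_idem _ (by omega), mul_assoc, mul_assoc,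
          ← mul_assoc (gt _ _ _ _), gt_mul_idem_mul_gt k (by omega)]
        refine incl_mul_mem _ (add_mem (add_mem ?_ (smul_mem_bimoduleSpan _ ?_))
          (smul_mem_bimoduleSpan _ ?_))
        · simpa using incl_mul_idem_mem (n := m + 1) (u := u) 1 k
        · rw [← incl_idem _ (by omega)]
          exact incl_mul_idem_mem _ k
        · rw [← incl_idem _ (by omega)]
          exact incl_mul_gt_mul_incl_mem rfl _ _
      · have : gt d u (m' + 1 + 1 + 1) (m' + 1) * incl d u (m' + 1 + 1)
            (incl d u (m' + 1) b * gt d u (m' + 1 + 1) m' * incl d u (m' + 1) c) *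
            gt d u (m' + 1 + 1 + 1) (m' + 1)
            = incl d u (m' + 1 + 1) (incl d u (m' + 1) b * gt d u (m' + 1 + 1) m') *
              gt d u (m' + 1 + 1 + 1) (m' + 1) *
              incl d u (m' + 1 + 1) (gt d u (m' + 1 + 1) m' * incl d u (m' + 1) c) := by
          simp only [map_mul, incl_gt (show m' + 1 < m' + 1 + 1 by omega)]
          exact braid_sandwich (incl_incl_mul_gt b) (incl_incl_mul_gt c) (gt_braid m').symm
        rw [this]
        exact incl_mul_gt_mul_incl_mem rfl _ _
    | zero => simp
    | add x y _ _ hx hy => rw [map_add, mul_add, add_mul]; exact add_mem hx hy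

/-- Every element of `Y_{d,n+1}(u)` is a sum of elements `ι(b) E_k(t_n)` and
`ι(b) g_{n-1} ι(c)`. -/
theorem decomposition {P : YH d u (n + 1) → Prop}
    (hadd : ∀ a b, P a → P b → P (a + b))
    (hT : ∀ b k, P (incl d u n b * idem d u (n + 1) k n))
    (hG : ∀ m, m + 1 = n → ∀ b c, P (incl d u n b * gt d u (n + 1) m * incl d u n c))
    (a : YH d u (n + 1)) : P a := by
  induction mem_bimoduleSpan a using AddSubmonoid.closure_induction with
  | mem x hx =>
    rcases hx with ⟨b, k, rfl⟩ | ⟨m, h, b, c, rfl⟩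
    · exact hT b k
    · exact hG m h b c
  | zero => simpa using hT 0 0
  | add x y _ _ hx hy => exact hadd x y hx hy

end YH

end Generators

/-! ### The induced representation and its defining relations. -/

section Representation

namespace YH

variable {d : ℕ} [NeZero d] {u : ℂ} {n : ℕ}

/-- The coefficients of the diagonal action of `t_j` in the induced representation. -/
noncomputable def repCoeff (d : ℕ) [NeZero d] (u : ℂ) (n : ℕ) (k : ZMod d) (j i : ℕ) : YH d u n :=
  if n < i then 1 else if i = j then (ZMod.stdAddChar k : ℂ) • 1
    else if j < i then tt d u n j else tt d u n (j - 1)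

/-- The action of `t_j` in the induced representation of `Y_{d,n+1}(u)` with coefficients in
`Y_{d,n}(u)`. The coefficient `c i` belongs to the vector `E_k(t_i) g_i ⋯ g_{n-1}`; the coefficients
with `n < i` play no role. -/
noncomputable def repT (d : ℕ) [NeZero d] (u : ℂ) (n : ℕ) (k : ZMod d) (j : ℕ) :
    Module.End ℂ (ℕ → YH d u n) :=
  Algebra.lmul ℂ (ℕ → YH d u n) (repCoeff d u n k j)

/-- The action of `g_j` in the induced representation of `Y_{d,n+1}(u)`. -/
noncomputable def repG (d : ℕ) [NeZero d] (u : ℂ) (n : ℕ) (k : ZMod d) (j : ℕ) :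
    Module.End ℂ (ℕ → YH d u n) where
  toFun c i :=
    if n < i then u • c i
    else if j + 1 < i then gt d u n j * c i
    else if i < j then gt d u n (j - 1) * c i
    else if i = j then c (j + 1) + (u - 1) • (idem d u n k j * c j)
    else c j + (u - 1) • (idem d u n k j * c j)
  map_add' c c' := by
    ext i
    simp only [Pi.add_apply, mul_add, smul_add]
    split_ifs <;> abel
  map_smul' a c := by
    ext i
    simp only [Pi.smul_apply, mul_smul_comm, RingHom.id_apply]
    split_ifs <;> simp only [smul_add, smul_comm a]

theorem repT_apply (k : ZMod d) (j : ℕ) (c : ℕ → YH d u n) (i : ℕ) :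
    repT d u n k j c i = repCoeff d u n k j i * c i := rfl

theorem repG_apply_of_lt (k : ZMod d) (j : ℕ) (c : ℕ → YH d u n) {i : ℕ} (h : n < i) :
    repG d u n k j c i = u • c i := by
  simp [repG, h]

theorem repG_apply_right (k : ZMod d) {j : ℕ} (c : ℕ → YH d u n) {i : ℕ} (hi : i ≤ n)
    (h : j + 1 < i) : repG d u n k j c i = gt d u n j * c i := by
  simp [repG, h, hi.not_gt]

theorem repG_apply_left (k : ZMod d) {j : ℕ} (c : ℕ → YH d u n) {i : ℕ} (hi : i ≤ n)
    (h : i < j) : repG d u n k j c i = gt d u n (j - 1) * c i := by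
  simp [repG, h, hi.not_gt, show ¬ j + 1 < i by omega]

theorem repG_apply_self (k : ZMod d) {j : ℕ} (c : ℕ → YH d u n) (hj : j ≤ n) :
    repG d u n k j c j = c (j + 1) + (u - 1) • (idem d u n k j * c j) := by
  simp [repG, hj.not_gt]

theorem repG_apply_succ (k : ZMod d) {j : ℕ} (c : ℕ → YH d u n) (hj : j + 1 ≤ n) :
    repG d u n k j c (j + 1) = c j + (u - 1) • (idem d u n k j * c j) := by
  simp [repG, hj.not_gt]

theorem repCoeff_of_lt (k : ZMod d) (j : ℕ) {i : ℕ} (h : n < i) : repCoeff d u n k j i = 1 := by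
  simp [repCoeff, h]

theorem repCoeff_self (k : ZMod d) {j : ℕ} (h : j ≤ n) :
    repCoeff d u n k j j = (ZMod.stdAddChar k : ℂ) • 1 := by
  simp [repCoeff, h.not_gt]

theorem repCoeff_right (k : ZMod d) {j i : ℕ} (hi : i ≤ n) (h : j < i) :
    repCoeff d u n k j i = tt d u n j := by
  simp [repCoeff, h, hi.not_gt, h.ne']

theorem repCoeff_left (k : ZMod d) {j i : ℕ} (hi : i ≤ n) (h : i < j) :
    repCoeff d u n k j i = tt d u n (j - 1) := by
  simp [repCoeff, hi.not_gt, h.ne, h.not_gt]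

theorem repCoeff_comm (k : ZMod d) (i j : ℕ) :
    repCoeff d u n k i * repCoeff d u n k j = repCoeff d u n k j * repCoeff d u n k i := by
  ext p
  simp only [Pi.mul_apply, repCoeff]
  split_ifs <;> simp [tt_comm]

theorem repCoeff_pow (k : ZMod d) (j : ℕ) : repCoeff d u n k j ^ d = 1 := by
  ext p
  simp only [Pi.pow_apply, repCoeff, Pi.one_apply]
  split_ifs
  · simp
  · exact smul_one_pow_card k
  · exact tt_pow _
  · exact tt_pow _

theorem repT_pow (k : ZMod d) (j : ℕ) : repT d u n k j ^ d = 1 := by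
  rw [repT, ← map_pow, repCoeff_pow, map_one]

theorem repT_comm (k : ZMod d) (i j : ℕ) :
    repT d u n k i * repT d u n k j = repT d u n k j * repT d u n k i := by
  rw [repT, repT, ← map_mul, repCoeff_comm, map_mul]

theorem yhE_repT_apply (k : ZMod d) (i : ℕ) (c : ℕ → YH d u n) (p : ℕ) :
    yhE d (repT d u n k i) (repT d u n k (i + 1)) c p
      = yhE d (repCoeff d u n k i p) (repCoeff d u n k (i + 1) p) * c p := by
  rw [repT, repT, ← map_yhE]
  change (yhE d (repCoeff d u n k i) (repCoeff d u n k (i + 1)) * c) p = _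
  rw [Pi.mul_apply]
  congr 1
  exact YH.map_yhE d (Pi.evalAlgHom ℂ (fun _ : ℕ => YH d u n) p) _ _

/-- The action of `e_i` in the induced representation. -/
noncomputable def repE (d : ℕ) [NeZero d] (u : ℂ) (n : ℕ) (k : ZMod d) (i p : ℕ) : YH d u n :=
  yhE d (repCoeff d u n k i p) (repCoeff d u n k (i + 1) p)

theorem repE_of_lt (k : ZMod d) (i : ℕ) {p : ℕ} (h : n < p) : repE d u n k i p = 1 := by
  rw [repE, repCoeff_of_lt k _ h, repCoeff_of_lt k _ h, yhE_one_one]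

theorem repE_self (k : ZMod d) {i : ℕ} (h : i ≤ n) : repE d u n k i i = idem d u n k i := by
  rw [repE, repCoeff_self k h, repCoeff_left k h (by omega), yhE_smul_one_left (tt_pow _)]
  rfl

theorem repE_succ (k : ZMod d) {i : ℕ} (h : i + 1 ≤ n) :
    repE d u n k i (i + 1) = idem d u n k i := by
  rw [repE, repCoeff_self k h, repCoeff_right k h (by omega), yhE_smul_one_right (tt_pow _)]
  rfl

theorem repE_right (k : ZMod d) {i p : ℕ} (hp : p ≤ n) (h : i + 1 < p) :
    repE d u n k i p = ee d u n i := by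
  rw [repE, repCoeff_right k hp h, repCoeff_right k hp (by omega), ee]

theorem repE_left (k : ZMod d) {i p : ℕ} (hp : p ≤ n) (h : p < i) :
    repE d u n k i p = ee d u n (i - 1) := by
  rw [repE, repCoeff_left k hp h, repCoeff_left k hp (by omega), ee]
  congr 2; omega

/-- Away from the coordinates `i`, `i + 1` the relation is the one of `Y_{d,n}`. On that pair `e_i`
acts as `E = E_k(t_i)`, `g_i` as the matrix with rows `((u-1)E, 1)` and `(1 + (u-1)E, 0)`, and `E² =
E` suffices. -/
theorem repG_sq (k : ZMod d) {i : ℕ} (hi : i < n) :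
    repG d u n k i * repG d u n k i
      = 1 + (u - 1) • yhE d (repT d u n k i) (repT d u n k (i + 1))
        + (u - 1) • (yhE d (repT d u n k i) (repT d u n k (i + 1)) * repG d u n k i) := by
  refine LinearMap.ext fun c => funext fun p => ?_
  simp only [Module.End.mul_apply, LinearMap.add_apply, LinearMap.smul_apply, Module.End.one_apply,
    Pi.add_apply, Pi.smul_apply, yhE_repT_apply]
  rw [← repE]
  rcases lt_or_ge n p with hp | hp
  -- The superfluous coordinates carry the character `g ↦ u`, `t ↦ 1`, which respects all relations;
  -- here `u² = 1 + (u-1) + (u-1)u`.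
  · simp only [repG_apply_of_lt k _ _ hp, repE_of_lt k _ hp, one_mul]
    module
  rcases lt_trichotomy p i with h | rfl | h
  · obtain ⟨i, rfl⟩ : ∃ j, i = j + 1 := ⟨i - 1, by omega⟩
    simp only [repG_apply_left k _ hp h, repE_left k hp h, Nat.add_sub_cancel]
    rw [← mul_assoc, gt_sq' hi]
    simp only [add_mul, smul_mul_assoc, one_mul, mul_assoc]
  · simp only [repG_apply_self k _ hp, repE_self k hp, repG_apply_succ k _ (show p + 1 ≤ n by omega)]
  · rcases (show i + 1 ≤ p from h).eq_or_lt with rfl | h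
    · simp only [repG_apply_self k _ (show i ≤ n by omega), repE_succ k hp, repG_apply_succ k _ hp]
      simp only [mul_add, mul_smul_comm, ← mul_assoc, idem_mul_self]
      module
    · simp only [repG_apply_right k _ hp h, repE_right k hp h]
      rw [← mul_assoc, gt_sq' (by omega)]
      simp only [add_mul, smul_mul_assoc, one_mul, mul_assoc]

theorem repG_far (k : ZMod d) {i j : ℕ} (hj : j < n) (hij : i + 1 < j) :
    repG d u n k i * repG d u n k j = repG d u n k j * repG d u n k i := by
  refine LinearMap.ext fun c => funext fun p => ?_
  obtain ⟨j, rfl⟩ : ∃ j', j = j' + 1 := ⟨j - 1, by omega⟩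
  simp only [Module.End.mul_apply]
  rcases lt_or_ge n p with hp | hp
  · simp only [repG_apply_of_lt k _ _ hp]
  rcases lt_trichotomy p i with h | rfl | h
  · obtain ⟨i, rfl⟩ : ∃ j, i = j + 1 := ⟨i - 1, by omega⟩
    simp only [repG_apply_left k _ hp h, repG_apply_left k _ hp (show p < j + 1 by omega),
      Nat.add_sub_cancel, ← mul_assoc]
    rw [gt_far (by omega)]
  · simp only [repG_apply_left k _ hp (show p < j + 1 by omega), repG_apply_self k _ hp,
      repG_apply_left k _ (show p + 1 ≤ n by omega) (show p + 1 < j + 1 by omega),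
      Nat.add_sub_cancel, mul_add, mul_smul_comm, ← mul_assoc,
      gt_mul_idem_of_ne k (show p ≠ j by omega) (show p ≠ j + 1 by omega)]
  rcases (show i + 1 ≤ p from h).eq_or_lt with rfl | h
  · simp only [repG_apply_left k _ hp (show i + 1 < j + 1 by omega), repG_apply_succ k _ hp,
      repG_apply_left k _ (show i ≤ n by omega) (show i < j + 1 by omega),
      Nat.add_sub_cancel, mul_add, mul_smul_comm, ← mul_assoc,
      gt_mul_idem_of_ne k (show i ≠ j by omega) (show i ≠ j + 1 by omega)]
  rcases lt_trichotomy p (j + 1) with h' | rfl | h'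
  · simp only [repG_apply_left k _ hp h', repG_apply_right k _ hp h,
      Nat.add_sub_cancel, ← mul_assoc]
    rw [gt_far (by omega)]
  · simp only [repG_apply_self k _ hp, repG_apply_right k _ hp h,
      repG_apply_right k _ (show j + 1 + 1 ≤ n by omega) (show i + 1 < j + 1 + 1 by omega),
      mul_add, mul_smul_comm, ← mul_assoc,
      gt_mul_idem_of_ne k (show j + 1 ≠ i by omega) (show j + 1 ≠ i + 1 by omega)]
  rcases (show j + 1 + 1 ≤ p from h').eq_or_lt with rfl | h'
  · simp only [repG_apply_succ k _ hp, repG_apply_right k _ hp h,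
      repG_apply_right k _ (show j + 1 ≤ n by omega) (show i + 1 < j + 1 by omega),
      mul_add, mul_smul_comm, ← mul_assoc,
      gt_mul_idem_of_ne k (show j + 1 ≠ i by omega) (show j + 1 ≠ i + 1 by omega)]
  · simp only [repG_apply_right k _ hp h, repG_apply_right k _ hp h', ← mul_assoc]
    rw [gt_far (by omega)]

theorem repG_braid (k : ZMod d) {i : ℕ} (hi : i + 1 < n) :
    repG d u n k i * repG d u n k (i + 1) * repG d u n k i
      = repG d u n k (i + 1) * repG d u n k i * repG d u n k (i + 1) := by
  refine LinearMap.ext fun c => funext fun p => ?_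
  simp only [Module.End.mul_apply]
  have hA : ∀ c, repG d u n k i c i = _ := fun c => repG_apply_self k c (by omega)
  have hB : ∀ c, repG d u n k i c (i + 1) = _ := fun c => repG_apply_succ k c (by omega)
  have hC : ∀ c, repG d u n k i c (i + 2) = gt d u n i * c (i + 2) :=
    fun c => repG_apply_right k c (by omega) (by omega)
  have hA' : ∀ c, repG d u n k (i + 1) c i = gt d u n i * c i :=
    fun c => repG_apply_left k c (by omega) (by omega)
  have hB' : ∀ c, repG d u n k (i + 1) c (i + 1) = _ := fun c => repG_apply_self k c (by omega)
  have hC' : ∀ c, repG d u n k (i + 1) c (i + 2) = _ := fun c => repG_apply_succ k c (by omega)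
  have e1 : ∀ x, gt d u n i * (idem d u n k i * x) = idem d u n k (i + 1) * (gt d u n i * x) := by
    intro x; simp only [← mul_assoc, gt_mul_idem_same]
  have e2 : ∀ x, gt d u n i * (idem d u n k (i + 1) * x) = idem d u n k i * (gt d u n i * x) := by
    intro x; simp only [← mul_assoc, gt_mul_idem_succ]
  have e3 : ∀ x, idem d u n k (i + 1) * (idem d u n k i * x)
      = idem d u n k i * (idem d u n k (i + 1) * x) := by
    intro x; simp only [← mul_assoc, idem_comm k k (i + 1)]
  -- The only use of the quadratic relation: at the coordinate `i` one side contains `g_i E_k(t_i)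
  -- g_i = E_k(t_{i+1}) g_i²`.
  have e4 : ∀ x, idem d u n k (i + 1) * (gt d u n i * (gt d u n i * x))
      = idem d u n k (i + 1) * x + (u - 1) • (idem d u n k i * (idem d u n k (i + 1) * x))
        + (u - 1) • (idem d u n k i * (idem d u n k (i + 1) * (gt d u n i * x))) := by
    intro x
    rw [← mul_assoc (gt _ _ _ _), gt_sq' hi]
    have : idem d u n k (i + 1) * ee d u n i = idem d u n k i * idem d u n k (i + 1) := by
      rw [ee_eq_sum, Finset.mul_sum]
      simp only [idem_comm (n := n) (u := u) k _ (i + 1) i, ← mul_assoc]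
      simp only [mul_assoc, idem_mul_idem]
      simp
    simp only [add_mul, mul_add, smul_mul_assoc, mul_smul_comm, one_mul, ← mul_assoc, this]
  rcases lt_or_ge n p with hp | hp
  · simp only [repG_apply_of_lt k _ _ hp]
  rcases lt_or_ge p i with h | h
  · obtain ⟨i, rfl⟩ : ∃ j, i = j + 1 := ⟨i - 1, by omega⟩
    simp only [repG_apply_left k _ hp h, repG_apply_left k _ hp (show p < i + 1 + 1 by omega),
      Nat.add_sub_cancel, ← mul_assoc]
    rw [gt_braid]
  rcases (show p = i ∨ p = i + 1 ∨ p = i + 2 ∨ i + 2 < p by omega) with rfl | rfl | rfl | h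
  · simp only [hA, hB, hA', hB', hC, mul_add, mul_smul_comm, smul_add, e1, e2, e4]
    simp only [e3]
    module
  · simp only [hA, hB, hA', hC', hB', hC, mul_add, mul_smul_comm, smul_add, e1, e2]
    simp only [e3]
    module
  · simp only [hB, hA', hC', hC, mul_add, mul_smul_comm, smul_add, e1, e2]
    simp only [e3]
    module
  · simp only [repG_apply_right k _ hp h, repG_apply_right k _ hp (show i + 1 < p by omega),
      ← mul_assoc]
    rw [gt_braid]

theorem repT_mul_repG (k : ZMod d) {i : ℕ} (hi : i < n) (j : ℕ) :
    repT d u n k j * repG d u n k i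
      = repG d u n k i * repT d u n k (Equiv.swap i (i + 1) j) := by
  refine LinearMap.ext fun c => funext fun p => ?_
  simp only [Module.End.mul_apply, repT_apply]
  rcases lt_or_ge n p with hp | hp
  · simp only [repG_apply_of_lt k _ _ hp, repCoeff_of_lt k _ hp, repT_apply, one_mul]
  have hself : ∀ x, tt d u n i * (idem d u n k i * x)
      = (ZMod.stdAddChar k : ℂ) • (idem d u n k i * x) := by
    intro x; rw [← mul_assoc, tt_mul_idem_same, smul_mul_assoc]
  have hE : ∀ l x, tt d u n l * (idem d u n k i * x) = idem d u n k i * (tt d u n l * x) := by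
    intro l x; rw [← mul_assoc, tt_mul_idem, mul_assoc]
  rcases lt_or_ge p i with h | h
  · obtain ⟨i, rfl⟩ : ∃ j, i = j + 1 := ⟨i - 1, by omega⟩
    rw [repG_apply_left k _ hp h, repG_apply_left k _ hp h, repT_apply, ← mul_assoc, ← mul_assoc]
    congr 1
    rcases eq_or_ne j (i + 1) with rfl | h1
    · rw [Equiv.swap_apply_left, repCoeff_left k hp h, repCoeff_left k hp (by omega)]
      exact tt_mul_gt_same i
    rcases eq_or_ne j (i + 1 + 1) with rfl | h2
    · rw [Equiv.swap_apply_right, repCoeff_left k hp h, repCoeff_left k hp (by omega)]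
      exact tt_succ_mul_gt i
    rw [Equiv.swap_apply_of_ne_of_ne h1 h2]
    rcases lt_trichotomy j p with h' | rfl | h'
    · rw [repCoeff_right k hp h', Nat.add_sub_cancel, tt_mul_gt_of_ne (by omega) (by omega)]
    · simp [repCoeff_self k hp]
    · rw [repCoeff_left k hp h', Nat.add_sub_cancel, tt_mul_gt_of_ne (by omega) (by omega)]
  rcases (show p = i ∨ p = i + 1 ∨ i + 1 < p by omega) with rfl | rfl | h
  · rw [repG_apply_self k _ hp, repG_apply_self k _ hp, repT_apply, repT_apply]
    rcases (show j = p ∨ j = p + 1 ∨ j < p ∨ p + 1 < j by omega) with rfl | rfl | h' | h'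
    · rw [Equiv.swap_apply_left, repCoeff_self k hp, repCoeff_self k (show j + 1 ≤ n by omega),
        repCoeff_left k hp (by omega), Nat.add_sub_cancel]
      simp only [mul_add, mul_smul_comm, smul_mul_assoc, one_mul, ← hE, hself]
    · rw [Equiv.swap_apply_right, repCoeff_self k hp,
        repCoeff_right k (show p + 1 ≤ n by omega) (by omega),
        repCoeff_left k hp (by omega), Nat.add_sub_cancel]
      simp only [mul_add, mul_smul_comm, smul_mul_assoc, one_mul, hself]
    · rw [Equiv.swap_apply_of_ne_of_ne (by omega) (by omega), repCoeff_right k hp h',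
        repCoeff_right k (show p + 1 ≤ n by omega) (by omega)]
      simp only [mul_add, mul_smul_comm, hE]
    · rw [Equiv.swap_apply_of_ne_of_ne (by omega) (by omega), repCoeff_left k hp (by omega),
        repCoeff_left k (show p + 1 ≤ n by omega) (by omega)]
      simp only [mul_add, mul_smul_comm, hE]
  · have hi' : i ≤ n := by omega
    rw [repG_apply_succ k _ hp, repG_apply_succ k _ hp, repT_apply]
    rcases (show j = i ∨ j = i + 1 ∨ j < i ∨ i + 1 < j by omega) with rfl | rfl | h' | h'
    · rw [Equiv.swap_apply_left, repCoeff_right k hp (by omega), repCoeff_left k hi' (by omega),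
        Nat.add_sub_cancel]
      simp only [mul_add, mul_smul_comm, hE]
    · rw [Equiv.swap_apply_right, repCoeff_self k hp, repCoeff_self k hi']
      simp only [mul_add, mul_smul_comm, smul_mul_assoc, one_mul]
    · rw [Equiv.swap_apply_of_ne_of_ne (by omega) (by omega), repCoeff_right k hp (by omega),
        repCoeff_right k hi' h']
      simp only [mul_add, mul_smul_comm, hE]
    · rw [Equiv.swap_apply_of_ne_of_ne (by omega) (by omega), repCoeff_left k hp (by omega),
        repCoeff_left k hi' (by omega)]
      simp only [mul_add, mul_smul_comm, hE]
  · rw [repG_apply_right k _ hp h, repG_apply_right k _ hp h, repT_apply, ← mul_assoc, ← mul_assoc]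
    congr 1
    rcases eq_or_ne j i with rfl | h1
    · rw [Equiv.swap_apply_left, repCoeff_right k hp (by omega), repCoeff_right k hp (by omega)]
      exact tt_mul_gt_same j
    rcases eq_or_ne j (i + 1) with rfl | h2
    · rw [Equiv.swap_apply_right, repCoeff_right k hp (by omega), repCoeff_right k hp (by omega)]
      exact tt_succ_mul_gt i
    rw [Equiv.swap_apply_of_ne_of_ne h1 h2]
    rcases lt_trichotomy j p with h' | rfl | h'
    · rw [repCoeff_right k hp h', tt_mul_gt_of_ne (by omega) (by omega)]
    · simp [repCoeff_self k hp]
    · rw [repCoeff_left k hp h', tt_mul_gt_of_ne (by omega) (by omega)]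

/-- The action of the generators in the induced representation. -/
noncomputable def repGen (d : ℕ) [NeZero d] (u : ℂ) (n : ℕ) (k : ZMod d) :
    YHGen (n + 1) → Module.End ℂ (ℕ → YH d u n)
  | YHGen.g i _ => repG d u n k i
  | YHGen.t j _ => repT d u n k j

/-- The induced representation of `Y_{d,n+1}(u)` with coefficients in `Y_{d,n}(u)`. -/
noncomputable def rep (d : ℕ) [NeZero d] (u : ℂ) (n : ℕ) (k : ZMod d) :
    YH d u (n + 1) →ₐ[ℂ] Module.End ℂ (ℕ → YH d u n) :=
  RingQuot.liftAlgHom ℂ ⟨FreeAlgebra.lift ℂ (repGen d u n k), fun a b h => by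
    induction h with
    | far i j hi hj hij =>
      rcases hij with hij | hij
      · simpa [YHGen.G, repGen] using repG_far k (by omega) hij
      · simpa [YHGen.G, repGen] using (repG_far k (by omega) hij).symm
    | braid i hi => simpa [YHGen.G, repGen] using repG_braid k (by omega)
    | frame_comm i j hi hj => simpa [YHGen.T, repGen] using repT_comm k i j
    | frame_braid i j hi hj =>
      simpa [YHGen.T, YHGen.G, repGen] using repT_mul_repG k (by omega) j
    | frame_pow j hj => simpa [YHGen.T, repGen] using repT_pow k j
    | quadratic i hi =>
      have hE : FreeAlgebra.lift ℂ (repGen d u n k) (yhE d (YHGen.T i (by omega))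
          (YHGen.T (i + 1) hi)) = yhE d (repT d u n k i) (repT d u n k (i + 1)) := by
        refine (YH.map_yhE d (FreeAlgebra.lift ℂ (repGen d u n k)) _ _).trans ?_
        simp [YHGen.T, repGen]
      simp only [map_add, map_mul, map_pow, map_one, map_smul, hE]
      simpa [YHGen.G, repGen, pow_two] using repG_sq k (by omega)⟩

theorem rep_gt (k : ZMod d) {i : ℕ} (h : i < n) :
    rep d u n k (gt d u (n + 1) i) = repG d u n k i := by
  rw [← g_eq_gt (by omega)]
  simp [rep, g, YHGen.G, repGen]

theorem rep_tt (k : ZMod d) {j : ℕ} (h : j ≤ n) :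
    rep d u n k (tt d u (n + 1) j) = repT d u n k j := by
  rw [← t_eq_tt (by omega)]
  simp [rep, t, YHGen.T, repGen]


end YH

end Representation

/-! ### The conditional expectation from `Y_{d,n+1}(u)` to `Y_{d,n}(u)`. -/

section Expectation

set_option linter.unusedSectionVars false

/-- The generator `g_j` mixes only the coordinates `j` and `j + 1`, so sums over coordinates are
compared termwise except on this pair. -/
theorem sum_range_congr_of_pair {M : Type*} [AddCommMonoid M] {f h : ℕ → M} {n j : ℕ}
    (hj : j + 1 < n) (hne : ∀ i < n, i ≠ j → i ≠ j + 1 → f i = h i)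
    (hp : f j + f (j + 1) = h j + h (j + 1)) :
    ∑ i ∈ Finset.range n, f i = ∑ i ∈ Finset.range n, h i := by
  have hsub : ({j, j + 1} : Finset ℕ) ⊆ Finset.range n := by
    intro i hi
    simp only [Finset.mem_insert, Finset.mem_singleton] at hi
    simp only [Finset.mem_range]; omega
  rw [← Finset.sum_sdiff hsub, ← Finset.sum_sdiff hsub, Finset.sum_pair (by omega),
    Finset.sum_pair (by omega), hp]
  congr 1
  refine Finset.sum_congr rfl fun i hi => ?_
  simp only [Finset.mem_sdiff, Finset.mem_range, Finset.mem_insert, Finset.mem_singleton,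
    not_or] at hi
  exact hne i hi.1 hi.2.1 hi.2.2

namespace YH

variable {d : ℕ} [NeZero d] {u : ℂ} {n : ℕ}

/-- The product `g_i g_{i+1} ⋯ g_{i+l-1}`. -/
noncomputable def gprod (d : ℕ) (u : ℂ) (n : ℕ) : ℕ → ℕ → YH d u n
  | 0, _ => 1
  | l + 1, i => gt d u n i * gprod d u n l (i + 1)

theorem tt_mul_gprod_of_lt {i j : ℕ} (l : ℕ) (h : j < i) :
    tt d u n j * gprod d u n l i = gprod d u n l i * tt d u n j := by
  induction l generalizing i with
  | zero => simp [gprod]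
  | succ l ih =>
    rw [gprod, ← mul_assoc, tt_mul_gt_of_ne (by omega) (by omega), mul_assoc, ih (by omega),
      mul_assoc]

theorem tt_mul_gprod_inner {i j : ℕ} (l : ℕ) (h : i ≤ j) (h' : j < i + l) :
    tt d u n (j + 1) * gprod d u n l i = gprod d u n l i * tt d u n j := by
  induction l generalizing i with
  | zero => omega
  | succ l ih =>
    rw [gprod]
    rcases h.eq_or_lt with rfl | h
    · rw [← mul_assoc, tt_succ_mul_gt, mul_assoc, tt_mul_gprod_of_lt _ (by omega), mul_assoc]
    · rw [← mul_assoc, tt_mul_gt_of_ne (by omega) (by omega), mul_assoc, ih (by omega) (by omega),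
        mul_assoc]

theorem gt_mul_gprod_of_lt {i j : ℕ} (l : ℕ) (h : j + 1 < i) :
    gt d u n j * gprod d u n l i = gprod d u n l i * gt d u n j := by
  induction l generalizing i with
  | zero => simp [gprod]
  | succ l ih => rw [gprod, ← mul_assoc, gt_far h, mul_assoc, ih (by omega), mul_assoc]

/-- The braid relation applies where `g_j g_{j+1}` occurs in the product, and the other factors
commute past. This drop of the index is the `j - 1` in `repG`. -/
theorem gt_mul_gprod_inner {i j : ℕ} (l : ℕ) (h : i ≤ j) (h' : j + 1 < i + l) :
    gt d u n (j + 1) * gprod d u n l i = gprod d u n l i * gt d u n j := by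
  induction l generalizing i with
  | zero => omega
  | succ l ih =>
    rcases h.eq_or_lt with rfl | h
    · obtain ⟨l, rfl⟩ : ∃ l', l = l' + 1 := ⟨l - 1, by omega⟩
      rw [gprod, gprod, ← mul_assoc, ← mul_assoc, ← gt_braid, mul_assoc, mul_assoc, mul_assoc,
        gt_mul_gprod_of_lt _ (by omega)]
      simp only [mul_assoc]
    · rw [gprod, ← mul_assoc, ← gt_far (by omega), mul_assoc, ih (by omega) (by omega), mul_assoc]

/-- The element `E_k(t_i) g_i ⋯ g_{n-2}` of `Y_{d,n}(u)`. -/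
noncomputable def chain (d : ℕ) [NeZero d] (u : ℂ) (n : ℕ) (k : ZMod d) (i : ℕ) : YH d u n :=
  idem d u n k i * gprod d u n (n - 1 - i) i

/-- The elements `chain` of `Y_{d,n}` obey the same multiplication rules as the vectors `E_k(t_i)
g_i ⋯ g_{n-1}`, which makes `repEval` compatible with the action of `Y_{d,n}`. -/
theorem tt_mul_chain (k : ZMod d) {i j : ℕ} (hi : i < n) (hj : j < n) :
    tt d u n j * chain d u n k i = chain d u n k i * repCoeff d u n k j i := by
  rw [chain]
  rcases lt_trichotomy j i with h | rfl | h
  · rw [repCoeff_right k hi.le h, ← mul_assoc, tt_mul_idem, mul_assoc, tt_mul_gprod_of_lt _ h,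
      mul_assoc]
  · rw [repCoeff_self k hi.le, ← mul_assoc, tt_mul_idem_same]
    simp
  · obtain ⟨j, rfl⟩ : ∃ j', j = j' + 1 := ⟨j - 1, by omega⟩
    rw [repCoeff_left k hi.le h, ← mul_assoc, tt_mul_idem, mul_assoc,
      tt_mul_gprod_inner _ (by omega) (by omega), mul_assoc, Nat.add_sub_cancel]

theorem gt_mul_chain_of_lt (k : ZMod d) {i j : ℕ} (h : j + 1 < i) :
    gt d u n j * chain d u n k i = chain d u n k i * gt d u n j := by
  rw [chain, ← mul_assoc, gt_mul_idem_of_ne k (by omega) (by omega), mul_assoc,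
    gt_mul_gprod_of_lt _ h, mul_assoc]

theorem gprod_eq {j : ℕ} (h : j + 1 < n) :
    gprod d u n (n - 1 - j) j = gt d u n j * gprod d u n (n - 1 - (j + 1)) (j + 1) := by
  rw [show n - 1 - j = (n - 1 - (j + 1)) + 1 by omega, gprod]

theorem gt_mul_chain_succ (k : ZMod d) {j : ℕ} (h : j + 1 < n) :
    gt d u n j * chain d u n k (j + 1) = chain d u n k j := by
  rw [chain, chain, ← mul_assoc, gt_mul_idem_succ, mul_assoc, gprod_eq h]

/-- The coefficients are those in the columns of `repG` for the coordinates `j` and `j + 1`. -/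
theorem gt_mul_chain_self (k : ZMod d) {j : ℕ} (h : j + 1 < n) :
    gt d u n j * chain d u n k j = chain d u n k (j + 1)
      + (u - 1) • (chain d u n k (j + 1) * idem d u n k j)
      + (u - 1) • (chain d u n k j * idem d u n k j) := by
  have h1 : gprod d u n (n - 1 - (j + 1)) (j + 1) * idem d u n k j
      = idem d u n k j * gprod d u n (n - 1 - (j + 1)) (j + 1) :=
    eigenIdem_semiconj (tt_mul_gprod_of_lt _ (by omega)).symm k
  rw [chain, gprod_eq h, ← mul_assoc, ← mul_assoc, gt_mul_idem_mul_gt k h]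
  simp only [chain, add_mul, smul_mul_assoc]
  simp only [mul_assoc, h1]
  rw [← mul_assoc (idem _ _ _ _ _) (idem _ _ _ _ _) (gprod _ _ _ _ _),
    ← mul_assoc (idem _ _ _ _ (j + 1)) (idem _ _ _ _ _) (gprod _ _ _ _ _), idem_comm]

theorem gt_mul_chain_of_gt (k : ZMod d) {i j : ℕ} (h : i < j) (hj : j + 1 < n) :
    gt d u n j * chain d u n k i = chain d u n k i * gt d u n (j - 1) := by
  obtain ⟨j, rfl⟩ : ∃ j', j = j' + 1 := ⟨j - 1, by omega⟩
  rw [chain, ← mul_assoc, gt_mul_idem_of_ne k (by omega) (by omega), mul_assoc,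
    gt_mul_gprod_inner _ (by omega) (by omega), mul_assoc, Nat.add_sub_cancel]

/-- The linear map that evaluates the conditional expectation on the induced representation. -/
noncomputable def repEval (d : ℕ) [NeZero d] (u : ℂ) (n : ℕ) (z w : ℂ) (k : ZMod d) :
    (ℕ → YH d u n) →ₗ[ℂ] YH d u n where
  toFun c := w • c n + z • ∑ i ∈ Finset.range n, chain d u n k i * c i
  map_add' c c' := by
    simp only [Pi.add_apply, mul_add, Finset.sum_add_distrib, smul_add]; abel
  map_smul' a c := by
    simp only [Pi.smul_apply, mul_smul_comm, ← Finset.smul_sum, smul_comm _ a, RingHom.id_apply,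
      smul_add]

theorem repEval_apply (z w : ℂ) (k : ZMod d) (c : ℕ → YH d u n) :
    repEval d u n z w k c = w • c n + z • ∑ i ∈ Finset.range n, chain d u n k i * c i := rfl

theorem repEval_repT (z w : ℂ) (k : ZMod d) (c : ℕ → YH d u n) {j : ℕ} (hj : j < n) :
    repEval d u n z w k (repT d u n k j c) = tt d u n j * repEval d u n z w k c := by
  rw [repEval_apply, repEval_apply, repT_apply, repCoeff_right k le_rfl hj, mul_add,
    mul_smul_comm, mul_smul_comm, Finset.mul_sum]
  congr 2
  refine Finset.sum_congr rfl fun i hi => ?_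
  rw [repT_apply, ← mul_assoc, ← mul_assoc, tt_mul_chain k (Finset.mem_range.mp hi) hj]

theorem repEval_repG (z w : ℂ) (k : ZMod d) (c : ℕ → YH d u n) {j : ℕ} (hj : j + 1 < n) :
    repEval d u n z w k (repG d u n k j c) = gt d u n j * repEval d u n z w k c := by
  rw [repEval_apply, repEval_apply, repG_apply_right k _ le_rfl hj, mul_add,
    mul_smul_comm, mul_smul_comm, Finset.mul_sum]
  congr 2
  refine sum_range_congr_of_pair hj (fun i hi h1 h2 => ?_) ?_
  · rcases lt_or_ge i j with h | h
    · rw [repG_apply_left k _ hi.le h, ← mul_assoc, ← mul_assoc, gt_mul_chain_of_gt k h hj]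
    · rw [repG_apply_right k _ hi.le (by omega), ← mul_assoc, ← mul_assoc,
        gt_mul_chain_of_lt k (by omega)]
  · rw [repG_apply_self k _ (by omega), repG_apply_succ k _ (by omega), ← mul_assoc, ← mul_assoc,
      gt_mul_chain_succ k hj, gt_mul_chain_self k hj]
    simp only [mul_add, add_mul, mul_smul_comm, smul_mul_assoc, mul_assoc]
    abel

theorem repEval_rep_incl (z w : ℂ) (k : ZMod d) (a : YH d u n) (c : ℕ → YH d u n) :
    repEval d u n z w k (rep d u n k (incl d u n a) c) = a * repEval d u n z w k c := by
  induction a using induction generalizing c with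
  | hc r =>
    rw [AlgHom.commutes, AlgHom.commutes, Module.algebraMap_end_apply, map_smul, Algebra.smul_def]
  | hadd a b ha hb => simp only [map_add, LinearMap.add_apply, ha, hb, add_mul]
  | hmul a b ha hb => simp only [map_mul, Module.End.mul_apply, ha, hb, mul_assoc]
  | hg i hi => rw [incl_gt hi, rep_gt k (by omega), repEval_repG z w k c hi]
  | ht j hj => rw [incl_tt hj, rep_tt k hj.le, repEval_repT z w k c hj]

/-- Every matrix entry of the action is a left multiplication or a scalar. -/
theorem rep_mul_right (k : ZMod d) (a : YH d u (n + 1)) (c : ℕ → YH d u n) (b : YH d u n) :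
    rep d u n k a (fun i => c i * b) = fun i => rep d u n k a c i * b := by
  induction a using induction generalizing c with
  | hc r =>
    ext i
    simp [Algebra.algebraMap_eq_smul_one]
  | hadd a a' ha ha' => ext i; simp [ha, ha', add_mul]
  | hmul a a' ha ha' => simp only [map_mul, Module.End.mul_apply, ha, ha']
  | hg i hi =>
    rw [rep_gt k (by omega)]
    ext p
    simp only [repG, LinearMap.coe_mk, AddHom.coe_mk]
    split_ifs <;> simp only [add_mul, smul_mul_assoc, mul_assoc]
  | ht j hj =>
    rw [rep_tt k (by omega)]
    ext p
    simp only [repT_apply, mul_assoc]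

/-- The generating vector of the induced representation. -/
noncomputable def repVec (d : ℕ) (u : ℂ) (n : ℕ) : ℕ → YH d u n := Pi.single n 1

/-- On the coordinate `n` the generators of `Y_{d,n}` act by plain left multiplication and do not
mix it with others. With `rep_mul_right` this makes `condExp` right linear. -/
theorem rep_incl_repVec (k : ZMod d) (b : YH d u n) :
    rep d u n k (incl d u n b) (repVec d u n) = fun i => repVec d u n i * b := by
  induction b using induction with
  | hc r =>
    ext i
    simp [Algebra.algebraMap_eq_smul_one]
  | hadd a b ha hb => ext i; simp [ha, hb, mul_add]
  | hmul a b ha hb =>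
    rw [map_mul, map_mul, Module.End.mul_apply, hb, rep_mul_right, ha]
    simp only [mul_assoc]
  | hg j hj =>
    rw [incl_gt hj, rep_gt k (by omega)]
    ext p
    rcases lt_or_ge n p with hp | hp
    · simp [repG_apply_of_lt k _ _ hp, repVec, hp.ne']
    rcases hp.eq_or_lt with rfl | hp'
    · simp [repG_apply_right k _ le_rfl hj, repVec]
    · have h0 : repVec d u n p = 0 := by simp [repVec, hp'.ne]
      rcases (show p < j ∨ p = j ∨ p = j + 1 ∨ j + 1 < p by omega) with h | rfl | rfl | h
      · simp [repG_apply_left k _ hp h, h0]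
      · rw [repG_apply_self k _ hp, h0]
        simp [repVec, hj.ne]
      · rw [repG_apply_succ k _ hp, h0]
        simp [repVec, show j ≠ n by omega]
      · simp [repG_apply_right k _ hp h, h0]
  | ht j hj =>
    rw [incl_tt hj, rep_tt k hj.le]
    ext p
    rw [repT_apply]
    by_cases hp : p = n
    · subst hp; simp [repCoeff_right k le_rfl hj, repVec]
    · simp [repVec, hp]

/-- The conditional expectation `Y_{d,n+1}(u) → Y_{d,n}(u)` for the Juyumaya trace: the map of
bimodules with `E_k(t_n) ↦ w_k` and `g_{n-1} ↦ z`. -/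
noncomputable def condExp (d : ℕ) [NeZero d] (u z : ℂ) (w : ZMod d → ℂ) (n : ℕ) :
    YH d u (n + 1) →ₗ[ℂ] YH d u n :=
  ∑ k : ZMod d, (repEval d u n z (w k) k ∘ₗ
    LinearMap.applyₗ (repVec d u n)) ∘ₗ (rep d u n k).toLinearMap

theorem condExp_apply (z : ℂ) (w : ZMod d → ℂ) (a : YH d u (n + 1)) :
    condExp d u z w n a
      = ∑ k : ZMod d, repEval d u n z (w k) k (rep d u n k a (repVec d u n)) := by
  simp [condExp]

theorem condExp_incl_mul (z : ℂ) (w : ZMod d → ℂ) (a : YH d u n) (b : YH d u (n + 1)) :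
    condExp d u z w n (incl d u n a * b) = a * condExp d u z w n b := by
  simp only [condExp_apply, map_mul, Module.End.mul_apply, repEval_rep_incl, Finset.mul_sum]

theorem repEval_mul_right (z w : ℂ) (k : ZMod d) (c : ℕ → YH d u n) (b : YH d u n) :
    repEval d u n z w k (fun i => c i * b) = repEval d u n z w k c * b := by
  simp only [repEval_apply, add_mul, smul_mul_assoc, Finset.sum_mul, mul_assoc]

theorem condExp_mul_incl (z : ℂ) (w : ZMod d → ℂ) (a : YH d u (n + 1)) (b : YH d u n) :
    condExp d u z w n (a * incl d u n b) = condExp d u z w n a * b := by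
  simp only [condExp_apply, map_mul, Module.End.mul_apply, rep_incl_repVec, rep_mul_right,
    repEval_mul_right, Finset.sum_mul]

theorem repEval_repVec (z w : ℂ) (k : ZMod d) :
    repEval d u n z w k (repVec d u n) = algebraMap ℂ _ w := by
  rw [repEval_apply, Finset.sum_eq_zero]
  · simp [repVec, Algebra.algebraMap_eq_smul_one]
  · intro i hi
    simp [repVec, (Finset.mem_range.mp hi).ne]

theorem rep_idem_repVec (k l : ZMod d) :
    rep d u n k (idem d u (n + 1) l n) (repVec d u n) = if l = k then repVec d u n else 0 := by
  have h1 : rep d u n k (idem d u (n + 1) l n)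
      = Algebra.lmul ℂ (ℕ → YH d u n) (eigenIdem l (repCoeff d u n k n)) := by
    simp only [idem, eigenIdem, map_smul, map_sum, map_pow, rep_tt k le_rfl, repT]
  rw [h1]
  ext p
  change eigenIdem l (repCoeff d u n k n) p * repVec d u n p = _
  by_cases hp : p = n
  · subst hp
    have h2 : eigenIdem l (repCoeff d u p k p) p = eigenIdem l (repCoeff d u p k p p) :=
      map_eigenIdem (Pi.evalAlgHom ℂ (fun _ : ℕ => YH d u p) p) l _
    rw [h2, repCoeff_self k le_rfl, eigenIdem_smul_one]
    split_ifs <;> simp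
  · split_ifs <;> simp [repVec, hp]

theorem condExp_idem (z : ℂ) (w : ZMod d → ℂ) (k : ZMod d) :
    condExp d u z w n (idem d u (n + 1) k n) = algebraMap ℂ _ (w k) := by
  simp only [condExp_apply, rep_idem_repVec]
  rw [Finset.sum_eq_single k]
  · simp [repEval_repVec]
  · intro l _ hl; simp [Ne.symm hl]
  · simp

theorem condExp_gt (z : ℂ) (w : ZMod d → ℂ) {m : ℕ} (h : m + 1 = n) :
    condExp d u z w n (gt d u (n + 1) m) = algebraMap ℂ _ z := by
  subst h
  have h1 : ∀ k, repG d u (m + 1) k m (repVec d u (m + 1)) = Pi.single m 1 := by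
    intro k
    ext p
    rcases lt_or_ge (m + 1) p with hp | hp
    · rw [repG_apply_of_lt k _ _ hp]
      simp [repVec, hp.ne', show p ≠ m by omega]
    rcases (show p < m ∨ p = m ∨ p = m + 1 by omega) with h | rfl | rfl
    · rw [repG_apply_left k _ hp h]
      simp [repVec, h.ne, show p ≠ m + 1 by omega]
    · rw [repG_apply_self k _ hp]
      simp [repVec]
    · rw [repG_apply_succ k _ hp]
      simp [repVec]
  -- The chain that starts at the last index has an empty product, so only `E_k(t_m)` remains; these
  -- sum to `1` over `k`.
  have h2 : ∀ k, repEval d u (m + 1) z (w k) k (Pi.single m 1) = z • idem d u (m + 1) k m := by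
    intro k
    rw [repEval_apply, Finset.sum_eq_single m]
    · simp [chain, gprod]
    · intro i _ hi; simp [hi]
    · simp
  simp only [condExp_apply, rep_gt _ (Nat.lt_succ_self m), h1, h2]
  rw [← Finset.smul_sum, sum_idem, Algebra.algebraMap_eq_smul_one]

end YH

end Expectation

/-! ### Construction of the trace and its cyclicity. -/

section Trace

set_option linter.unusedSectionVars false

namespace YH

variable {d : ℕ} [NeZero d] {u : ℂ} {n : ℕ}

/-- The isomorphism of `Y_{d,0}(u)` with `ℂ`, as a homomorphism. -/
noncomputable def aug (d : ℕ) (u : ℂ) : YH d u 0 →ₐ[ℂ] ℂ :=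
  RingQuot.liftAlgHom ℂ ⟨FreeAlgebra.lift ℂ fun _ => 0, fun a b h => by cases h <;> omega⟩

/-- The trace on `Y_{d,n}(u)` that is built from the conditional expectations. -/
noncomputable def jtrace (d : ℕ) [NeZero d] (u z : ℂ) (w : ZMod d → ℂ) :
    ∀ n : ℕ, YH d u n →ₗ[ℂ] ℂ
  | 0 => (aug d u).toLinearMap
  | n + 1 => jtrace d u z w n ∘ₗ condExp d u z w n

variable (z : ℂ) (w : ZMod d → ℂ)

theorem jtrace_succ (a : YH d u (n + 1)) :
    jtrace d u z w (n + 1) a = jtrace d u z w n (condExp d u z w n a) := rfl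

theorem condExp_incl_mul_gt_mul_incl {m : ℕ} (h : m + 1 = n) (a b : YH d u n) :
    condExp d u z w n (incl d u n a * gt d u (n + 1) m * incl d u n b) = z • (a * b) := by
  rw [condExp_mul_incl, condExp_incl_mul, condExp_gt z w h, ← Algebra.commutes,
    ← Algebra.smul_def, smul_mul_assoc]

theorem condExp_incl_mul_idem (a : YH d u n) (k : ZMod d) :
    condExp d u z w n (incl d u n a * idem d u (n + 1) k n) = w k • a := by
  rw [condExp_incl_mul, condExp_idem, ← Algebra.commutes, ← Algebra.smul_def]

/-- The map `a ↦ E(g_{n-1} a g_{n-1})` for the conditional expectation `E`. -/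
noncomputable def conjExp (d : ℕ) [NeZero d] (u z : ℂ) (w : ZMod d → ℂ) (m : ℕ)
    (a : YH d u (m + 1)) : YH d u (m + 1) :=
  condExp d u z w (m + 1) (gt d u (m + 2) m * incl d u (m + 1) a * gt d u (m + 2) m)

/-- The conjugating generator commutes with everything from two levels down. So `conjExp` is a
bimodule map and is determined by its values on `E_k(t_n)` and `g_{n-1}`. -/
theorem conjExp_incl_mul (a : YH d u n) (b : YH d u (n + 1)) :
    conjExp d u z w n (incl d u n a * b) = incl d u n a * conjExp d u z w n b := by
  rw [conjExp, conjExp, ← condExp_incl_mul, map_mul (incl d u _), ← mul_assoc, ← mul_assoc, ← mul_assoc,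
    incl_incl_mul_gt]

theorem conjExp_mul_incl (a : YH d u n) (b : YH d u (n + 1)) :
    conjExp d u z w n (b * incl d u n a) = conjExp d u z w n b * incl d u n a := by
  rw [conjExp, conjExp, ← condExp_mul_incl, map_mul (incl d u _), mul_assoc, mul_assoc, mul_assoc, mul_assoc,
    incl_incl_mul_gt]

theorem conjExp_add (a b : YH d u (n + 1)) :
    conjExp d u z w n (a + b) = conjExp d u z w n a + conjExp d u z w n b := by
  simp only [conjExp, map_add, mul_add, add_mul]

theorem conjExp_idem (k : ZMod d) :
    conjExp d u z w n (idem d u (n + 1) k n)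
      = w k • 1 + ((u - 1) * (w k + z)) • idem d u (n + 1) k n := by
  rw [conjExp, incl_idem _ (by omega), gt_mul_idem_mul_gt k (by omega), map_add, map_add, map_smul,
    map_smul, condExp_idem, ← incl_idem _ (by omega), condExp_incl_mul_idem,
    condExp_incl_mul_gt_mul_incl z w rfl, idem_mul_self, Algebra.algebraMap_eq_smul_one]
  module

/-- The braid relation leaves one top generator, which the expectation replaces by `z`, between two
copies of the lower one. -/
theorem conjExp_gt {m : ℕ} (h : m + 1 = n) :
    conjExp d u z w n (gt d u (n + 1) m) = z • (gt d u (n + 1) m * gt d u (n + 1) m) := by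
  subst h
  rw [conjExp, incl_gt (by omega), ← gt_braid, ← incl_gt (by omega),
    condExp_incl_mul_gt_mul_incl z w rfl]

theorem conjExp_idem' {m : ℕ} (h : m + 1 = n) (k : ZMod d) :
    condExp d u z w n (gt d u (n + 1) m * idem d u (n + 1) k m * gt d u (n + 1) m)
      = w k • 1 + ((u - 1) * (w k + z)) • idem d u n k m := by
  subst h
  rw [← incl_idem _ (by omega)]
  exact conjExp_idem z w k

/-- The element `g_{n-1} ι(b) g_{n-1}` commutes with `E_k(t_{n-1})`. -/
theorem idem_mul_gt_incl_gt {m : ℕ} (h : m + 1 = n) (k : ZMod d) (b : YH d u n) :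
    idem d u (n + 1) k m * (gt d u (n + 1) m * incl d u n b * gt d u (n + 1) m)
      = gt d u (n + 1) m * incl d u n b * gt d u (n + 1) m * idem d u (n + 1) k m := by
  subst h
  rw [mul_assoc _ (gt _ _ _ _) (idem _ _ _ _ _), gt_mul_idem_same, ← mul_assoc,
    ← mul_assoc, ← gt_mul_idem_succ, mul_assoc (gt _ _ _ _) (idem _ _ _ _ _) (incl _ _ _ _),
    ← incl_mul_idem]
  simp only [mul_assoc]

/-- Expand `g²` by the quadratic relation. The terms with `1` and `e` contain a single `g` beside
the other one's replacement and are evaluated by the expectation; the term with `e g` needs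
cyclicity. -/
theorem trace_gt_sq_swap
    (hcomm : ∀ a b, jtrace d u z w (n + 1) (a * b) = jtrace d u z w (n + 1) (b * a))
    {m : ℕ} (h : m + 1 = n) (a b : YH d u n) :
    jtrace d u z w (n + 1)
        (incl d u n a * gt d u (n + 1) m * incl d u n b * (gt d u (n + 1) m * gt d u (n + 1) m))
      = jtrace d u z w (n + 1)
        (incl d u n a * (gt d u (n + 1) m * gt d u (n + 1) m) * incl d u n b * gt d u (n + 1) m) := by
  have hGE : ∀ k, gt d u (n + 1) m * idem d u (n + 1) k n
      = idem d u (n + 1) k m * gt d u (n + 1) m := by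
    intro k; subst h; exact gt_mul_idem_succ k m
  have hEG : ∀ k, idem d u (n + 1) k n * gt d u (n + 1) m
      = gt d u (n + 1) m * idem d u (n + 1) k m := by
    intro k; subst h; exact (gt_mul_idem_same k m).symm
  have hE : ∀ k, idem d u (n + 1) k m = incl d u n (idem d u n k m) := by
    intro k; rw [incl_idem _ (by omega)]
  have hee : ee d u (n + 1) m = ∑ k : ZMod d, idem d u (n + 1) k n * idem d u (n + 1) k m := by
    subst h
    rw [ee_eq_sum]
    exact Finset.sum_congr rfl fun k _ => idem_comm _ _ _ _
  have hX := fun k b => idem_mul_gt_incl_gt (d := d) (u := u) h k b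
  set g := gt d u (n + 1) m
  set A := incl d u n a with hA
  set B := incl d u n b with hB
  rw [gt_sq' (by omega : m + 1 < n + 1)]
  simp only [mul_add, add_mul, mul_one, map_add, mul_smul_comm, smul_mul_assoc, map_smul]
  have h0 : jtrace d u z w (n + 1) (A * g * B) = jtrace d u z w (n + 1) (A * B * g) := by
    have := condExp_incl_mul_gt_mul_incl z w h (a * b) 1
    rw [map_one, mul_one, map_mul (incl d u _), mul_one] at this
    rw [jtrace_succ, jtrace_succ, this, condExp_incl_mul_gt_mul_incl z w h]
  have h1 : jtrace d u z w (n + 1) (A * g * B * ee d u (n + 1) m)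
      = jtrace d u z w (n + 1) (A * ee d u (n + 1) m * B * g) := by
    simp only [hee, Finset.mul_sum, Finset.sum_mul, map_sum]
    refine Finset.sum_congr rfl fun k _ => ?_
    have e1 : A * g * B * (idem d u (n + 1) k n * idem d u (n + 1) k m)
        = incl d u n (a * idem d u n k m) * g * incl d u n (b * idem d u n k m) := by
      rw [map_mul, map_mul, ← hE, ← mul_assoc, mul_assoc _ B, incl_mul_idem, ← mul_assoc,
        mul_assoc A, hGE]
      simp only [mul_assoc, hA]
    have e2 : A * (idem d u (n + 1) k n * idem d u (n + 1) k m) * B * g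
        = incl d u n (a * idem d u n k m * b) * g * incl d u n (idem d u n k m) := by
      rw [map_mul, map_mul, ← hE, idem_comm, mul_assoc _ g, ← hEG, ← hA, ← hB]
      simp only [mul_assoc]
      rw [← mul_assoc B, incl_mul_idem, mul_assoc]
    rw [jtrace_succ, jtrace_succ, e1, e2, condExp_incl_mul_gt_mul_incl z w h,
      condExp_incl_mul_gt_mul_incl z w h]
    simp only [mul_assoc]
  -- Both sides become words in `E = E_k(t_m)`. Since `E` commutes with `g ι(b) g`, cyclic moves
  -- carry it from one side of `B` to the other.
  have h2 : jtrace d u z w (n + 1) (A * g * B * (ee d u (n + 1) m * g))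
      = jtrace d u z w (n + 1) (A * (ee d u (n + 1) m * g) * B * g) := by
    simp only [hee, Finset.mul_sum, Finset.sum_mul, map_sum]
    refine Finset.sum_congr rfl fun k _ => ?_
    set E := idem d u (n + 1) k m
    have e1 : A * g * B * (idem d u (n + 1) k n * E * g)
        = A * E * g * (B * E) * g := by
      have := hX k (b * idem d u n k m)
      rw [map_mul, ← hE] at this
      calc A * g * B * (idem d u (n + 1) k n * E * g)
          = A * g * B * (E * (idem d u (n + 1) k n * g)) := by
            rw [idem_comm]; simp only [mul_assoc, E]
        _ = A * (g * (B * E) * g * E) := by rw [hEG]; simp only [mul_assoc, E]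
        _ = A * (E * (g * (B * E) * g)) := by rw [this]
        _ = _ := by simp only [mul_assoc]
    have e2 : A * (idem d u (n + 1) k n * E * g) * B * g
        = A * E * g * (E * B) * g := by
      calc A * (idem d u (n + 1) k n * E * g) * B * g
          = A * (E * (idem d u (n + 1) k n * g)) * B * g := by
            rw [idem_comm]; simp only [mul_assoc, E]
        _ = _ := by rw [hEG]; simp only [mul_assoc, E]
    have hY := hX k (a * idem d u n k m)
    rw [map_mul, ← hE, ← hA] at hY
    calc jtrace d u z w (n + 1) (A * g * B * (idem d u (n + 1) k n * E * g))
        = jtrace d u z w (n + 1) ((g * (A * E) * g * B) * E) := by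
          rw [e1, hcomm]; simp only [mul_assoc]
      _ = jtrace d u z w (n + 1) (E * (g * (A * E) * g) * B) := by
          rw [hcomm]; simp only [mul_assoc]
      _ = jtrace d u z w (n + 1) (g * (A * E * g * (E * B))) := by
          rw [hY]; simp only [mul_assoc, E]
      _ = _ := by rw [e2, hcomm]
  rw [h0, h1, h2]

/-- By `decomposition` both arguments may be taken of the form `ι(a) E_k(t_n)` or `ι(a) g_{n-1}
ι(a')`. Cases with an `E_k` are evaluated directly; two braiding generators lead to
`trace_gt_sq_swap`. -/
theorem jtrace_mul_conjExp
    (hcomm : ∀ a b, jtrace d u z w (n + 1) (a * b) = jtrace d u z w (n + 1) (b * a))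
    (a b : YH d u (n + 1)) :
    jtrace d u z w (n + 1) (a * conjExp d u z w n b)
      = jtrace d u z w (n + 1) (conjExp d u z w n a * b) := by
  induction a using decomposition with
  | hadd a a' ha ha' => rw [conjExp_add, add_mul, add_mul, map_add, map_add, ha, ha']
  | hT a k =>
    induction b using decomposition with
    | hadd b b' hb hb' => rw [conjExp_add, mul_add, mul_add, map_add, map_add, hb, hb']
    | hT b l =>
      have e1 : incl d u n a * idem d u (n + 1) k n *
          conjExp d u z w n (incl d u n b * idem d u (n + 1) l n)
          = w l • (incl d u n (a * b) * idem d u (n + 1) k n)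
            + ((u - 1) * (w l + z)) • (incl d u n (a * b) *
              (idem d u (n + 1) k n * idem d u (n + 1) l n)) := by
        rw [conjExp_incl_mul, conjExp_idem, ← mul_assoc, mul_assoc (incl _ _ _ a), ← incl_mul_idem,
          ← mul_assoc, ← map_mul, mul_add, mul_smul_comm, mul_smul_comm, mul_one, mul_assoc]
      have e2 : conjExp d u z w n (incl d u n a * idem d u (n + 1) k n) *
          (incl d u n b * idem d u (n + 1) l n)
          = w k • (incl d u n (a * b) * idem d u (n + 1) l n)
            + ((u - 1) * (w k + z)) • (incl d u n (a * b) *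
              (idem d u (n + 1) k n * idem d u (n + 1) l n)) := by
        rw [conjExp_incl_mul, conjExp_idem, mul_add, add_mul, mul_smul_comm, mul_smul_comm, mul_one,
          smul_mul_assoc, smul_mul_assoc, ← mul_assoc, ← map_mul, ← mul_assoc,
          mul_assoc (incl _ _ _ a), ← incl_mul_idem, ← mul_assoc, ← map_mul, mul_assoc]
      rw [e1, e2, idem_mul_idem]
      simp only [map_add, map_smul, jtrace_succ, condExp_incl_mul_idem, smul_smul]
      by_cases h : k = l
      · subst h; rfl
      · simp [h, mul_comm]
    | hG m h b c =>
      have hE : conjExp d u z w n (incl d u n a * idem d u (n + 1) k n)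
          = incl d u n a * (w k • 1 + ((u - 1) * (w k + z)) • idem d u (n + 1) k n) := by
        rw [conjExp_incl_mul, conjExp_idem]
      have hb : conjExp d u z w n (incl d u n b * gt d u (n + 1) m * incl d u n c)
          = z • (incl d u n b * (gt d u (n + 1) m * gt d u (n + 1) m) * incl d u n c) := by
        rw [conjExp_mul_incl, conjExp_incl_mul, conjExp_gt z w h, mul_smul_comm, smul_mul_assoc]
      have hg : idem d u (n + 1) k n * gt d u (n + 1) m
          = gt d u (n + 1) m * incl d u n (idem d u n k m) := by
        subst h; rw [incl_idem _ (by omega), gt_mul_idem_same]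
      have hg' : idem d u (n + 1) k n * (gt d u (n + 1) m * gt d u (n + 1) m)
          = gt d u (n + 1) m * idem d u (n + 1) k m * gt d u (n + 1) m := by
        rw [← mul_assoc, hg, incl_idem _ (by omega)]
      have e1 : incl d u n a * idem d u (n + 1) k n *
          (incl d u n b * (gt d u (n + 1) m * gt d u (n + 1) m) * incl d u n c)
          = incl d u n (a * b) * (gt d u (n + 1) m * idem d u (n + 1) k m * gt d u (n + 1) m)
            * incl d u n c := by
        rw [← hg', map_mul, ← mul_assoc, ← mul_assoc, mul_assoc (incl _ _ _ a), ← incl_mul_idem]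
        simp only [mul_assoc]
      have e2 : incl d u n a * (w k • 1 + ((u - 1) * (w k + z)) • idem d u (n + 1) k n) *
          (incl d u n b * gt d u (n + 1) m * incl d u n c)
          = w k • (incl d u n (a * b) * gt d u (n + 1) m * incl d u n c)
            + ((u - 1) * (w k + z)) •
              (incl d u n (a * b) * gt d u (n + 1) m * incl d u n (idem d u n k m * c)) := by
        rw [map_mul, map_mul, mul_assoc _ (gt _ _ _ _) (incl _ _ _ _ * _), ← mul_assoc (gt _ _ _ _),
          ← hg]
        simp only [mul_add, add_mul, mul_smul_comm, smul_mul_assoc, mul_one, mul_assoc]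
        rw [← mul_assoc (incl _ _ _ b) (idem _ _ _ _ _), incl_mul_idem, mul_assoc]
      rw [hE, hb, mul_smul_comm, map_smul, e1, e2, map_add, map_smul, map_smul, jtrace_succ,
        jtrace_succ, jtrace_succ, condExp_incl_mul_gt_mul_incl z w h,
        condExp_incl_mul_gt_mul_incl z w h, condExp_mul_incl, condExp_incl_mul,
        conjExp_idem' z w h]
      simp only [mul_add, add_mul, mul_smul_comm, smul_mul_assoc, map_add, map_smul, mul_one,
        smul_eq_mul, mul_assoc]
      ring
  | hG m h a a' =>
    have hg2 : conjExp d u z w n (incl d u n a * gt d u (n + 1) m * incl d u n a')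
          = z • (incl d u n a * (gt d u (n + 1) m * gt d u (n + 1) m) * incl d u n a') := by
        rw [conjExp_mul_incl, conjExp_incl_mul, conjExp_gt z w h, mul_smul_comm, smul_mul_assoc]
    induction b using decomposition with
    | hadd b b' hb hb' => rw [conjExp_add, mul_add, mul_add, map_add, map_add, hb, hb']
    | hT b k =>
      have hE : conjExp d u z w n (incl d u n b * idem d u (n + 1) k n)
          = (w k • 1 + ((u - 1) * (w k + z)) • idem d u (n + 1) k n) * incl d u n b := by
        rw [incl_mul_idem, conjExp_mul_incl, conjExp_idem]
      have hg : gt d u (n + 1) m * idem d u (n + 1) k n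
          = incl d u n (idem d u n k m) * gt d u (n + 1) m := by
        subst h; rw [incl_idem _ (by omega), gt_mul_idem_succ]
      have hg' : gt d u (n + 1) m * gt d u (n + 1) m * idem d u (n + 1) k n
          = gt d u (n + 1) m * idem d u (n + 1) k m * gt d u (n + 1) m := by
        rw [mul_assoc, hg, incl_idem _ (by omega), ← mul_assoc]
      have e1 : incl d u n a * (gt d u (n + 1) m * gt d u (n + 1) m) * incl d u n a' *
          (incl d u n b * idem d u (n + 1) k n)
          = incl d u n a * (gt d u (n + 1) m * idem d u (n + 1) k m * gt d u (n + 1) m)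
            * incl d u n (a' * b) := by
        rw [← hg', map_mul, mul_assoc _ (incl _ _ _ a'), ← mul_assoc (incl _ _ _ a'), ← map_mul,
          incl_mul_idem]
        simp only [mul_assoc]
      have e2 : incl d u n a * gt d u (n + 1) m * incl d u n a' *
          ((w k • 1 + ((u - 1) * (w k + z)) • idem d u (n + 1) k n) * incl d u n b)
          = w k • (incl d u n a * gt d u (n + 1) m * incl d u n (a' * b))
            + ((u - 1) * (w k + z)) •
              (incl d u n (a * idem d u n k m) * gt d u (n + 1) m * incl d u n (a' * b)) := by
        rw [map_mul, map_mul, mul_assoc _ (incl _ _ _ (idem _ _ _ _ _)), ← hg]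
        simp only [mul_add, add_mul, mul_smul_comm, smul_mul_assoc, one_mul, mul_assoc]
        rw [← mul_assoc (incl _ _ _ a'), incl_mul_idem, mul_assoc]
      rw [hE, hg2, smul_mul_assoc, map_smul, e1, e2, map_add, map_smul, map_smul, jtrace_succ,
        jtrace_succ, jtrace_succ, condExp_incl_mul_gt_mul_incl z w h,
        condExp_incl_mul_gt_mul_incl z w h, condExp_mul_incl, condExp_incl_mul,
        conjExp_idem' z w h]
      simp only [mul_add, add_mul, mul_smul_comm, smul_mul_assoc, map_add, map_smul, mul_one,
        smul_eq_mul, mul_assoc]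
      ring
    | hG m' h' b b' =>
      obtain rfl : m' = m := by omega
      have hb : conjExp d u z w n (incl d u n b * gt d u (n + 1) m' * incl d u n b')
          = z • (incl d u n b * (gt d u (n + 1) m' * gt d u (n + 1) m') * incl d u n b') := by
        rw [conjExp_mul_incl, conjExp_incl_mul, conjExp_gt z w h, mul_smul_comm, smul_mul_assoc]
      -- Cyclicity moves `ι(b')` to the front, so only the products `b' a` and `a' b` enter.
      have key := trace_gt_sq_swap z w hcomm h (b' * a) (a' * b)
      rw [hg2, hb, mul_smul_comm, smul_mul_assoc, map_smul, map_smul, ← mul_assoc _ _ (incl _ _ _ b'),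
        ← mul_assoc _ _ (incl _ _ _ b'), hcomm _ (incl _ _ _ b'), hcomm _ (incl _ _ _ b')]
      congr 1
      simpa only [map_mul, mul_assoc] using key

/-- By induction on `n`, with `b` reduced to a generator. Elements of `ι(Y_{d,n})` are covered by
the bimodule property, `t_n` and `g_{n-1}` by decomposing `a`. -/
theorem jtrace_comm : ∀ (n : ℕ) (a b : YH d u n),
    jtrace d u z w n (a * b) = jtrace d u z w n (b * a) := by
  intro n
  induction n with
  | zero => intro a b; simp [jtrace, mul_comm]
  | succ n ih =>
    have hincl : ∀ (a : YH d u (n + 1)) (b : YH d u n),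
        jtrace d u z w (n + 1) (a * incl d u n b) = jtrace d u z w (n + 1) (incl d u n b * a) := by
      intro a b
      rw [jtrace_succ, jtrace_succ, condExp_incl_mul, condExp_mul_incl, ih]
    intro a b
    induction b using induction generalizing a with
    | hc r => rw [Algebra.commutes]
    | hadd b b' hb hb' => rw [mul_add, add_mul, map_add, map_add, hb, hb']
    | hmul b b' hb hb' => rw [← mul_assoc, hb', ← mul_assoc, hb, mul_assoc]
    | hg i hi =>
      rcases (show i + 1 < n ∨ i + 1 = n by omega) with h | h
      · rw [← incl_gt h, hincl]
      · induction a using decomposition with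
        | hadd a a' ha ha' => rw [add_mul, mul_add, map_add, map_add, ha, ha']
        | hT a k =>
          have e1 : incl d u n a * idem d u (n + 1) k n * gt d u (n + 1) i
              = incl d u n a * gt d u (n + 1) i * incl d u n (idem d u n k i) := by
            subst h; rw [mul_assoc, ← gt_mul_idem_same, incl_idem _ (by omega), mul_assoc]
          have e2 : gt d u (n + 1) i * (incl d u n a * idem d u (n + 1) k n)
              = incl d u n (idem d u n k i) * gt d u (n + 1) i * incl d u n a := by
            subst h
            rw [incl_mul_idem, ← mul_assoc, gt_mul_idem_succ, incl_idem _ (by omega)]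
          rw [e1, e2, jtrace_succ, jtrace_succ, condExp_incl_mul_gt_mul_incl z w h,
            condExp_incl_mul_gt_mul_incl z w h, map_smul, map_smul, ih]
        | hG m hm a a' =>
          obtain rfl : m = i := by omega
          subst h
          -- The hard case: `tr(a g a' g) = tr(a E(g a' g))` and `tr(g a g a') = tr(E(g a g) a')`.
          have := jtrace_mul_conjExp z w ih a a'
          rw [conjExp, conjExp, ← condExp_incl_mul, ← condExp_mul_incl, ← jtrace_succ,
            ← jtrace_succ] at this
          simpa only [mul_assoc] using this
    | ht j hj =>
      rcases (show j < n ∨ j = n by omega) with h | rfl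
      · rw [← incl_tt h, hincl]
      · induction a using decomposition with
        | hadd a a' ha ha' => rw [add_mul, mul_add, map_add, map_add, ha, ha']
        | hT a k =>
          rw [← mul_assoc, ← incl_mul_tt, mul_assoc, mul_assoc, tt_mul_idem]
        | hG m h a a' =>
          have e1 : incl d u j a * gt d u (j + 1) m * incl d u j a' * tt d u (j + 1) j
              = incl d u j (a * tt d u j m) * gt d u (j + 1) m * incl d u j a' := by
            subst h
            rw [mul_assoc, incl_mul_tt, ← mul_assoc, mul_assoc (incl _ _ _ a), ← tt_mul_gt_same,
              map_mul, incl_tt (by omega)]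
            simp only [mul_assoc]
          have e2 : tt d u (j + 1) j * (incl d u j a * gt d u (j + 1) m * incl d u j a')
              = incl d u j a * gt d u (j + 1) m * incl d u j (tt d u j m * a') := by
            subst h
            rw [← mul_assoc, ← mul_assoc, ← incl_mul_tt, mul_assoc (incl _ _ _ a), tt_succ_mul_gt,
              map_mul, incl_tt (by omega)]
            simp only [mul_assoc]
          rw [e1, e2, jtrace_succ, jtrace_succ, condExp_incl_mul_gt_mul_incl z w h,
            condExp_incl_mul_gt_mul_incl z w h, mul_assoc]

end YH

end Trace

/-! ### Existence and uniqueness of the Juyumaya trace. -/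

section Juyumaya

set_option linter.unusedSectionVars false

variable {d : ℕ} [NeZero d] {u z : ℂ} {x : ZMod d → ℂ}

/-- The value of the Juyumaya trace on the idempotents of the framing generators: the Fourier
transform of the parameters, divided by `d`. -/
noncomputable def frameWeight (x : ZMod d → ℂ) (k : ZMod d) : ℂ := (1 / (d : ℂ)) * ZMod.dft x k

theorem sum_stdAddChar_mul_frameWeight (x : ZMod d → ℂ) (m : ZMod d) :
    ∑ k : ZMod d, (ZMod.stdAddChar (k * m) : ℂ) * frameWeight x k = x m := by
  have h := congrFun (ZMod.dft.symm_apply_apply x) m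
  rw [ZMod.invDFT_apply] at h
  rw [← h, Finset.smul_sum]
  refine Finset.sum_congr rfl fun k _ => ?_
  simp only [frameWeight, smul_eq_mul]
  ring

theorem frameWeight_eq (x : ZMod d → ℂ) (k : ZMod d) :
    frameWeight x k = (1 / (d : ℂ)) * ∑ m : ZMod d, (ZMod.stdAddChar (-(m * k)) : ℂ) * x m := by
  rw [frameWeight, ZMod.dft_apply]
  simp

namespace YH

theorem isJuyumayaTrace_jtrace (hx : x 0 = 1) :
    IsJuyumayaTrace d u z x (jtrace d u z (frameWeight x)) where
  compat n a := by
    have h := sum_stdAddChar_mul_frameWeight x 0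
    simp only [mul_zero, AddChar.map_zero_eq_one, one_mul, hx] at h
    have h1 : incl d u n a = ∑ k : ZMod d, incl d u n a * idem d u (n + 1) k n := by
      rw [← Finset.mul_sum, sum_idem, mul_one]
    rw [jtrace_succ, h1]
    simp only [map_sum, condExp_incl_mul_idem, map_smul]
    rw [← Finset.sum_smul, h, one_smul]
  one n := by
    have h := sum_stdAddChar_mul_frameWeight x 0
    simp only [mul_zero, AddChar.map_zero_eq_one, one_mul, hx] at h
    induction n with
    | zero => simp [jtrace]
    | succ n ih =>
      rw [jtrace_succ, ← sum_idem (d := d) n, map_sum]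
      simp only [condExp_idem]
      rw [← map_sum, h, map_one, ih]
  comm := jtrace_comm z _
  markov n a := by
    rw [g_eq_gt, jtrace_succ]
    have := condExp_incl_mul_gt_mul_incl (d := d) (u := u) z (frameWeight x) (n := n + 1) rfl a 1
    rw [map_one, mul_one, mul_one] at this
    rw [this, map_smul, smul_eq_mul]
  frame n a m _ _ := by
    rw [t_eq_tt, jtrace_succ, pow_eq_sum_eigenIdem (tt_pow n), Finset.mul_sum, map_sum, map_sum,
      ← sum_stdAddChar_mul_frameWeight x m, Finset.sum_mul]
    refine Finset.sum_congr rfl fun k _ => ?_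
    rw [mul_smul_comm, map_smul, ← idem, condExp_incl_mul_idem]
    simp only [map_smul, smul_eq_mul, mul_assoc]

end YH

namespace IsJuyumayaTrace

open YH

variable {tr : ∀ n : ℕ, YH d u n →ₗ[ℂ] ℂ}

theorem map_incl_mul_pow (h : IsJuyumayaTrace d u z x tr) (hx : x 0 = 1) {n : ℕ} (a : YH d u n)
    (m : ZMod d) : tr (n + 1) (incl d u n a * tt d u (n + 1) n ^ m.val) = x m * tr n a := by
  by_cases hm : m = 0
  · subst hm
    rw [ZMod.val_zero, pow_zero, mul_one, h.compat, hx, one_mul]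
  · have h1 : m.val ≠ 0 := fun h => hm ((ZMod.val_eq_zero m).mp h)
    have h2 := ZMod.val_lt m
    have := h.frame n a m.val (by omega) (by omega)
    rwa [t_eq_tt, ZMod.natCast_zmod_val] at this

/-- Expanding `E_k` in powers of `t_n` turns the parameters `x_m` into their Fourier transform. -/
theorem map_incl_mul_idem (h : IsJuyumayaTrace d u z x tr) (hx : x 0 = 1) {n : ℕ} (a : YH d u n)
    (k : ZMod d) :
    tr (n + 1) (incl d u n a * idem d u (n + 1) k n) = frameWeight x k * tr n a := by
  rw [idem, eigenIdem, frameWeight_eq]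
  simp only [mul_smul_comm, Finset.mul_sum, map_smul, map_sum, h.map_incl_mul_pow hx, smul_eq_mul,
    Finset.sum_mul, mul_assoc]

theorem map_incl_mul_gt_mul_incl (h : IsJuyumayaTrace d u z x tr) {n m : ℕ} (hm : m + 1 = n)
    (a b : YH d u n) :
    tr (n + 1) (incl d u n a * gt d u (n + 1) m * incl d u n b) = z * tr n (a * b) := by
  subst hm
  have := h.markov m (b * a)
  rw [g_eq_gt, map_mul (incl d u _)] at this
  rw [h.comm, ← mul_assoc, this, h.comm]

/-- The trace rules fix the values on both kinds of summand in `decomposition` in terms of the trace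
one level down; `Y_{d,0}` consists of scalars. -/
theorem ext (h : IsJuyumayaTrace d u z x tr) (hx : x 0 = 1)
    {tr' : ∀ n : ℕ, YH d u n →ₗ[ℂ] ℂ} (h' : IsJuyumayaTrace d u z x tr') : tr = tr' := by
  funext n
  induction n with
  | zero =>
    ext a
    have key : ∀ a : YH d u 0, ∃ c : ℂ, a = c • 1 := by
      intro a
      induction a using YH.induction with
      | hc c => exact ⟨c, Algebra.algebraMap_eq_smul_one c⟩
      | hadd a b ha hb =>
        obtain ⟨c, rfl⟩ := ha
        obtain ⟨c', rfl⟩ := hb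
        exact ⟨c + c', (add_smul _ _ _).symm⟩
      | hmul a b ha hb =>
        obtain ⟨c, rfl⟩ := ha
        obtain ⟨c', rfl⟩ := hb
        exact ⟨c * c', by rw [smul_mul_smul_comm, one_mul]⟩
      | hg i hi => omega
      | ht j hj => omega
    obtain ⟨c, rfl⟩ := key a
    rw [map_smul, map_smul, h.one, h'.one]
  | succ n ih =>
    ext a
    induction a using decomposition with
    | hadd a b ha hb => rw [map_add, map_add, ha, hb]
    | hT a k => rw [h.map_incl_mul_idem hx, h'.map_incl_mul_idem hx, ih]
    | hG m hm a b => rw [h.map_incl_mul_gt_mul_incl hm, h'.map_incl_mul_gt_mul_incl hm, ih]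

end IsJuyumayaTrace

theorem existsUnique_juyumayaTrace (d : ℕ) [NeZero d] (u z : ℂ) (x : ZMod d → ℂ) (hx : x 0 = 1) :
    ∃! tr : ∀ n : ℕ, YH d u n →ₗ[ℂ] ℂ, IsJuyumayaTrace d u z x tr :=
  ⟨_, YH.isJuyumayaTrace_jtrace hx, fun _ h => h.ext hx (YH.isJuyumayaTrace_jtrace hx)⟩

end Juyumaya

/-! ### The ideal of the quotient and the trace of its generators. -/

section Quotient

set_option linter.unusedSectionVars false

variable {d : ℕ} [NeZero d] {u z : ℂ} {x : ZMod d → ℂ} {n : ℕ}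

theorem yhE_semiconj {A : Type*} [Ring A] [Algebra ℂ A] {a a' b b' c : A}
    (ha : SemiconjBy c a a') (hb : SemiconjBy c b b') :
    SemiconjBy c (yhE d a b) (yhE d a' b') := by
  simp only [SemiconjBy, yhE, mul_smul_comm, smul_mul_assoc, Finset.mul_sum, Finset.sum_mul]
  congr 1
  exact Finset.sum_congr rfl fun s _ => ((ha.pow_right s).mul_right (hb.pow_right (d - s))).eq

namespace YH

/-- The element `g_{i,i+1}` for all indices. -/
noncomputable def ggt (d : ℕ) (u : ℂ) (n i : ℕ) : YH d u n :=
  gt d u n i * gt d u n (i + 1) * gt d u n i + gt d u n (i + 1) * gt d u n i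
    + gt d u n i * gt d u n (i + 1) + gt d u n i + gt d u n (i + 1) + 1

/-- The element `r_{i,i+1}` for all indices. -/
noncomputable def rt (d : ℕ) (u : ℂ) (n i : ℕ) : YH d u n :=
  ee d u n i * ee d u n (i + 1) * ggt d u n i

theorem r_eq_rt {i : ℕ} (h : i + 2 < n) : r d u i h = rt d u n i := by
  simp only [r, gg, e, rt, ggt, ee, g_eq_gt, t_eq_tt]

theorem incl_ggt {i : ℕ} (h : i + 2 < n) : incl d u n (ggt d u n i) = ggt d u (n + 1) i := by
  simp only [ggt, map_add, map_mul, map_one, incl_gt (show i + 1 < n by omega),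
    incl_gt (show i + 1 + 1 < n by omega)]

theorem incl_rt {i : ℕ} (h : i + 2 < n) : incl d u n (rt d u n i) = rt d u (n + 1) i := by
  simp only [rt, map_mul, incl_ggt h, incl_ee (show i + 1 < n by omega),
    incl_ee (show i + 1 + 1 < n by omega)]

/-- The element `E_k(t_i) E_k(t_{i+1}) E_k(t_{i+2}) g_{i,i+1}`. -/
noncomputable def rIdem (d : ℕ) [NeZero d] (u : ℂ) (n : ℕ) (k : ZMod d) (i : ℕ) : YH d u n :=
  idem d u n k i * idem d u n k (i + 1) * idem d u n k (i + 2) * ggt d u n i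

theorem incl_rIdem (k : ZMod d) {i : ℕ} (h : i + 2 < n) :
    incl d u n (rIdem d u n k i) = rIdem d u (n + 1) k i := by
  simp only [rIdem, map_mul, incl_ggt h, incl_idem k (show i < n by omega),
    incl_idem k (show i + 1 < n by omega), incl_idem k (show i + 2 < n by omega)]

/-- The character propagates: `E_k(t_i)` selects `E_k(t_{i+1})` in `e_i`, which selects
`E_k(t_{i+2})` in `e_{i+1}`. -/
theorem idem_mul_rt (k : ZMod d) (i : ℕ) :
    idem d u n k i * rt d u n i = rIdem d u n k i := by
  rw [rt, rIdem, ← mul_assoc, ← mul_assoc, idem_mul_ee, mul_assoc (idem _ _ _ _ _) _ (ee _ _ _ _),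
    idem_mul_ee]
  simp only [mul_assoc, add_assoc, Nat.reduceAdd]

theorem rt_eq_sum (i : ℕ) : rt d u n i = ∑ k : ZMod d, rIdem d u n k i := by
  rw [← one_mul (rt d u n i), ← sum_idem i, Finset.sum_mul]
  exact Finset.sum_congr rfl fun k _ => idem_mul_rt k i

theorem gt_mul_idem_pair (k : ZMod d) (i : ℕ) :
    gt d u n i * (idem d u n k i * idem d u n k (i + 1))
      = idem d u n k i * idem d u n k (i + 1) * gt d u n i := by
  rw [← mul_assoc, gt_mul_idem_same, mul_assoc, gt_mul_idem_succ, ← mul_assoc, idem_comm]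

/-- Under `E_k(t_i) E_k(t_{i+1})` the quadratic relation is the Hecke relation `(g - u)(g + 1) = 0`.
-/
theorem idem_pair_mul_gt (k : ZMod d) {i : ℕ} (h : i + 1 < n) :
    idem d u n k i * idem d u n k (i + 1) * (gt d u n i * (1 + gt d u n i))
      = u • (idem d u n k i * idem d u n k (i + 1) * (1 + gt d u n i)) := by
  have h1 : idem d u n k i * idem d u n k (i + 1) * (gt d u n i * gt d u n i)
      = u • (idem d u n k i * idem d u n k (i + 1))
        + (u - 1) • (idem d u n k i * idem d u n k (i + 1) * gt d u n i) := by
    rw [idem_comm, mul_assoc, idem_mul_gt_sq k h]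
    simp only [mul_add, mul_smul_comm]
    rw [← mul_assoc _ (idem _ _ _ _ _ * _) (gt _ _ _ _), idem_comm k k i, ← mul_assoc,
      idem_mul_self]
    module
  rw [mul_add, mul_one, mul_add, h1, mul_add, mul_one]
  module

/-- The left factor `1 + g_i`, and likewise `1 + g_{i+1}` after a braid move, makes both generators
act on `rIdem` by `u`. -/
theorem ggt_eq_left (i : ℕ) :
    ggt d u n i = (1 + gt d u n i) * (1 + gt d u n (i + 1) + gt d u n (i + 1) * gt d u n i) := by
  rw [ggt]; noncomm_ring

theorem ggt_eq_right (i : ℕ) :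
    ggt d u n i = (1 + gt d u n (i + 1)) * (1 + gt d u n i + gt d u n i * gt d u n (i + 1)) := by
  rw [ggt, gt_braid]; noncomm_ring

theorem gt_mul_rIdem (k : ZMod d) {i : ℕ} (h : i + 1 < n) :
    gt d u n i * rIdem d u n k i = u • rIdem d u n k i := by
  have h1 : gt d u n i * idem d u n k (i + 2) = idem d u n k (i + 2) * gt d u n i :=
    gt_mul_idem_of_ne k (by omega) (by omega)
  have h2 : idem d u n k i * idem d u n k (i + 1) * idem d u n k (i + 2)
      = idem d u n k (i + 2) * (idem d u n k i * idem d u n k (i + 1)) := by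
    rw [mul_assoc, idem_comm k k (i + 1), ← mul_assoc, idem_comm k k i, mul_assoc]
  rw [rIdem, h2, ggt_eq_left]
  simp only [← mul_assoc]
  rw [h1]
  simp only [mul_assoc]
  rw [← mul_assoc (idem _ _ _ _ i), ← mul_assoc (gt _ _ _ i) (_ * _), gt_mul_idem_pair]
  rw [mul_assoc _ (gt _ _ _ i), ← mul_assoc (gt _ _ _ i) (1 + _), ← mul_assoc (_ * _) (_ * _),
    idem_pair_mul_gt k h]
  simp only [smul_mul_assoc, mul_smul_comm, mul_assoc]

theorem gt_succ_mul_rIdem (k : ZMod d) {i : ℕ} (h : i + 2 < n) :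
    gt d u n (i + 1) * rIdem d u n k i = u • rIdem d u n k i := by
  have h1 : gt d u n (i + 1) * idem d u n k i = idem d u n k i * gt d u n (i + 1) :=
    gt_mul_idem_of_ne k (by omega) (by omega)
  have h2 := gt_mul_idem_pair (u := u) (n := n) k (i + 1)
  rw [rIdem, ggt_eq_right]
  simp only [← mul_assoc]
  rw [h1]
  simp only [mul_assoc]
  rw [← mul_assoc (idem _ _ _ _ (i + 1)), ← mul_assoc (gt _ _ _ (i + 1)) (_ * _), h2]
  rw [mul_assoc _ (gt _ _ _ (i + 1)), ← mul_assoc (gt _ _ _ (i + 1)) (1 + _),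
    ← mul_assoc (_ * _) (_ * _), idem_pair_mul_gt k h]
  simp only [smul_mul_assoc, mul_smul_comm, mul_assoc]

theorem tt_mul_rIdem (k : ZMod d) {i j : ℕ} (h : i ≤ j) (h' : j ≤ i + 2) :
    tt d u n j * rIdem d u n k i = (ZMod.stdAddChar k : ℂ) • rIdem d u n k i := by
  have e1 : ∀ l y, tt d u n j * (idem d u n k l * y) = idem d u n k l * (tt d u n j * y) := by
    intro l y; rw [← mul_assoc, tt_mul_idem, mul_assoc]
  have e2 : ∀ y, tt d u n j * (idem d u n k j * y)
      = (ZMod.stdAddChar k : ℂ) • (idem d u n k j * y) := by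
    intro y; rw [← mul_assoc, tt_mul_idem_same, smul_mul_assoc]
  rw [rIdem]
  simp only [mul_assoc]
  rcases (show j = i ∨ j = i + 1 ∨ j = i + 2 by omega) with rfl | rfl | rfl
  · rw [e2]
  · rw [e1, e2, mul_smul_comm]
  · rw [e1, e1, e2, mul_smul_comm, mul_smul_comm]

/-- For `n = 3` every generator involves only the three strands of `rIdem`, so each acts on it by a
scalar. -/
theorem exists_mul_rIdem (k : ZMod d) (b : YH d u 3) :
    ∃ c : ℂ, b * rIdem d u 3 k 0 = c • rIdem d u 3 k 0 := by
  induction b using induction with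
  | hc c => exact ⟨c, by rw [← Algebra.smul_def]⟩
  | hadd a b ha hb =>
    obtain ⟨c, hc⟩ := ha
    obtain ⟨c', hc'⟩ := hb
    exact ⟨c + c', by rw [add_mul, hc, hc', add_smul]⟩
  | hmul a b ha hb =>
    obtain ⟨c, hc⟩ := ha
    obtain ⟨c', hc'⟩ := hb
    exact ⟨c' * c, by rw [mul_assoc, hc', mul_smul_comm, hc, smul_smul]⟩
  | hg i hi =>
    refine ⟨u, ?_⟩
    rcases (show i = 0 ∨ i = 1 by omega) with rfl | rfl
    · exact gt_mul_rIdem k (by omega)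
    · exact gt_succ_mul_rIdem k (by omega)
  | ht j hj => exact ⟨_, tt_mul_rIdem k (by omega) (by omega)⟩

/-- The element `g_i g_{i+1} g_{i+2}`, which conjugates `r_{i,i+1}` to `r_{i+1,i+2}`. -/
noncomputable def shift (d : ℕ) (u : ℂ) (n i : ℕ) : YH d u n :=
  gt d u n i * gt d u n (i + 1) * gt d u n (i + 2)

theorem shift_semiconj_gt (i : ℕ) :
    SemiconjBy (shift d u n i) (gt d u n i) (gt d u n (i + 1)) := by
  rw [SemiconjBy, shift, mul_assoc, ← gt_far (show i + 1 < i + 2 by omega), ← mul_assoc, gt_braid]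
  simp only [mul_assoc]

theorem shift_semiconj_gt_succ (i : ℕ) :
    SemiconjBy (shift d u n i) (gt d u n (i + 1)) (gt d u n (i + 2)) := by
  have := gt_braid (d := d) (u := u) (n := n) (i + 1)
  rw [SemiconjBy, shift, mul_assoc, mul_assoc, ← mul_assoc (gt _ _ _ (i + 1)), this]
  simp only [← mul_assoc]
  rw [gt_far (show i + 1 < i + 2 by omega)]

theorem shift_semiconj_tt {i j : ℕ} (h : i ≤ j) (h' : j ≤ i + 2) :
    SemiconjBy (shift d u n i) (tt d u n j) (tt d u n (j + 1)) := by
  have e0 : ∀ {a b : ℕ}, b ≠ a → b ≠ a + 1 →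
      SemiconjBy (gt d u n a) (tt d u n b) (tt d u n b) :=
    fun h1 h2 => (tt_mul_gt_of_ne h1 h2).symm
  have e1 : ∀ a, SemiconjBy (gt d u n a) (tt d u n a) (tt d u n (a + 1)) :=
    fun a => (tt_succ_mul_gt a).symm
  rw [shift]
  rcases (show j = i ∨ j = i + 1 ∨ j = i + 2 by omega) with rfl | rfl | rfl
  · exact ((e1 j).mul_left (e0 (by omega) (by omega))).mul_left (e0 (by omega) (by omega))
  · exact ((e0 (by omega) (by omega)).mul_left (e1 (i + 1))).mul_left (e0 (by omega) (by omega))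
  · exact ((e0 (by omega) (by omega)).mul_left (e0 (by omega) (by omega))).mul_left (e1 (i + 2))

theorem shift_semiconj_rt (i : ℕ) :
    SemiconjBy (shift d u n i) (rt d u n i) (rt d u n (i + 1)) := by
  have g0 := shift_semiconj_gt (d := d) (u := u) (n := n) i
  have g1 := shift_semiconj_gt_succ (d := d) (u := u) (n := n) i
  have t0 := shift_semiconj_tt (d := d) (u := u) (n := n) (i := i) (j := i) le_rfl (by omega)
  have t1 := shift_semiconj_tt (d := d) (u := u) (n := n) (i := i) (j := i + 1) (by omega)
    (by omega)
  have t2 := shift_semiconj_tt (d := d) (u := u) (n := n) (i := i) (j := i + 2) (by omega) le_rfl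
  exact ((yhE_semiconj t0 t1).mul_right (yhE_semiconj t1 t2)).mul_right
    ((((((g0.mul_right g1).mul_right g0).add_right (g1.mul_right g0)).add_right
      (g0.mul_right g1)).add_right g0).add_right g1 |>.add_right (SemiconjBy.one_right _))

theorem exists_gt_mul_eq_one (hu : u ≠ 0) {i : ℕ} (h : i + 1 < n) :
    ∃ y, gt d u n i * y = 1 := by
  -- Solving the quadratic relation for `g⁻¹`: multiplied by `e` it gives `e g⁻¹ = u⁻¹ (e g - (u-1)
  -- e)`, and then `g⁻¹ = g - (u-1) e g⁻¹ - (u-1) e`.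
  refine ⟨gt d u n i - ((u - 1) / u) • (ee d u n i * (gt d u n i + 1)), ?_⟩
  have h1 : ee d u n i * (gt d u n i * gt d u n i)
      = u • ee d u n i + (u - 1) • (ee d u n i * gt d u n i) := by
    rw [gt_sq' h]
    simp only [mul_add, mul_one, mul_smul_comm, ← mul_assoc, ee_mul_self]
    module
  rw [mul_sub, mul_smul_comm, ← mul_assoc, gt_mul_ee, mul_assoc, mul_add, mul_one, mul_add, h1,
    gt_sq' h]
  have h2 : (u - 1) / u * u = u - 1 := div_mul_cancel₀ _ hu
  have h3 : ((u - 1) / u) • (u • ee d u n i + (u - 1) • (ee d u n i * gt d u n i)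
      + ee d u n i * gt d u n i)
      = ((u - 1) / u * u) • ee d u n i + ((u - 1) / u * u) • (ee d u n i * gt d u n i) := by
    module
  rw [h3, h2]
  abel

theorem exists_shift_mul_eq_one (hu : u ≠ 0) {i : ℕ} (h : i + 3 < n) :
    ∃ y, shift d u n i * y = 1 := by
  obtain ⟨a, ha⟩ := exists_gt_mul_eq_one (d := d) hu (show i + 1 < n by omega)
  obtain ⟨b, hb⟩ := exists_gt_mul_eq_one (d := d) hu (show i + 1 + 1 < n by omega)
  obtain ⟨c, hc⟩ := exists_gt_mul_eq_one (d := d) hu (show i + 2 + 1 < n by omega)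
  refine ⟨c * (b * a), ?_⟩
  rw [shift, mul_assoc, mul_assoc, ← mul_assoc _ c, hc, one_mul, ← mul_assoc _ b, hb, one_mul, ha]

end YH

namespace IsJuyumayaTrace

open YH

variable {tr : ∀ n : ℕ, YH d u n →ₗ[ℂ] ℂ}

/-- For `i = 0`, `decomposition` and the trace rules lower `n` to `3`, where `b` acts on each
`rIdem` by a scalar. Larger `i` follow by conjugation with `shift` and cyclicity. -/
theorem map_mul_rt_eq_zero (h : IsJuyumayaTrace d u z x tr) (hx : x 0 = 1) (hu : u ≠ 0)
    (h0 : ∀ k, tr 3 (rIdem d u 3 k 0) = 0) {n : ℕ} (hn : 3 ≤ n) {i : ℕ} (hi : i + 2 < n)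
    (b : YH d u n) : tr n (b * rt d u n i) = 0 := by
  induction i generalizing b with
  | zero =>
    clear hi
    induction n, hn using Nat.le_induction with
    | base =>
      rw [rt_eq_sum, Finset.mul_sum, map_sum]
      refine Finset.sum_eq_zero fun k _ => ?_
      obtain ⟨c, hc⟩ := exists_mul_rIdem k b
      rw [hc, map_smul, h0, smul_zero]
    | succ n hn ih =>
      rw [← incl_rt (show 0 + 2 < n by omega)]
      induction b using decomposition with
      | hadd a b ha hb => rw [add_mul, map_add, ha, hb, add_zero]
      | hT b k =>
        rw [mul_assoc, ← incl_mul_idem, ← mul_assoc, ← map_mul, h.map_incl_mul_idem hx, ih,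
          mul_zero]
      | hG m hm b c =>
        rw [mul_assoc, ← map_mul, h.map_incl_mul_gt_mul_incl hm, ← mul_assoc, ih, mul_zero]
  | succ i ih =>
    obtain ⟨y, hy⟩ := exists_shift_mul_eq_one (d := d) hu (show i + 3 < n by omega)
    have : rt d u n (i + 1) = shift d u n i * rt d u n i * y := by
      rw [(shift_semiconj_rt i).eq, mul_assoc, hy, mul_one]
    rw [this, ← mul_assoc, h.comm, ← mul_assoc, ← mul_assoc]
    exact ih (by omega) _

theorem map_rIdem_eq (h : IsJuyumayaTrace d u z x tr) (k : ZMod d) {n : ℕ} (hn : 3 ≤ n) :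
    tr n (rIdem d u n k 0) = tr 3 (rIdem d u 3 k 0) := by
  induction n, hn using Nat.le_induction with
  | base => rfl
  | succ n hn ih => rw [← incl_rIdem k (by omega), h.compat, ih]

/-- With `w = frameWeight x k`, the six terms of `g_{0,1}` contribute `w³ + 2zw² + 2z²w + z(uw² +
(u-1)zw)`. Moving `E_k(t_2)` past `g_1` brings each word into the form of a trace rule. -/
theorem map_rIdem (h : IsJuyumayaTrace d u z x tr) (hx : x 0 = 1) (k : ZMod d) :
    tr 3 (rIdem d u 3 k 0) = frameWeight x k *
      (frameWeight x k + z) * (frameWeight x k + (u + 1) * z) := by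
  have t1 : tr 1 (idem d u 1 k 0) = frameWeight x k := by
    have := h.map_incl_mul_idem hx (1 : YH d u 0) k
    rwa [map_one, one_mul, h.one, mul_one] at this
  have t2 : tr 2 (idem d u 2 k 0 * idem d u 2 k 1) = frameWeight x k ^ 2 := by
    have := h.map_incl_mul_idem hx (idem d u 1 k 0) k
    rw [incl_idem k (by omega), t1] at this
    rw [this, sq]
  have t2g : tr 2 (idem d u 2 k 0 * idem d u 2 k 1 * gt d u 2 0) = z * frameWeight x k := by
    have := h.map_incl_mul_gt_mul_incl (m := 0) rfl (idem d u 1 k 0) (idem d u 1 k 0)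
    rw [incl_idem k (by omega), idem_mul_self, t1] at this
    rw [mul_assoc, ← gt_mul_idem_same, ← mul_assoc, this]
  have t2gg : tr 2 (idem d u 2 k 0 * idem d u 2 k 1 * gt d u 2 0 * gt d u 2 0)
      = u * frameWeight x k ^ 2 + (u - 1) * (z * frameWeight x k) := by
    have := idem_pair_mul_gt (u := u) (n := 2) k (i := 0) (by omega)
    simp only [mul_add, mul_one, ← mul_assoc, smul_add] at this
    have := congrArg (tr 2) this
    simp only [map_add, map_smul, zero_add, t2, t2g, smul_eq_mul] at this
    linear_combination this
  have i0 := incl_idem (u := u) (n := 2) k (j := 0) (by omega)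
  have i1 := incl_idem (u := u) (n := 2) k (j := 1) (by omega)
  have ig := incl_gt (d := d) (u := u) (n := 2) (i := 0) (by omega)
  have g2 : ∀ y, idem d u 3 k 2 * (gt d u 3 1 * y) = gt d u 3 1 * (idem d u 3 k 1 * y) := by
    intro y; rw [← mul_assoc, ← gt_mul_idem_same, mul_assoc]
  have g2' : idem d u 3 k 2 * gt d u 3 1 = gt d u 3 1 * idem d u 3 k 1 :=
    (gt_mul_idem_same k 1).symm
  have g0 : ∀ y, idem d u 3 k 2 * (gt d u 3 0 * y) = gt d u 3 0 * (idem d u 3 k 2 * y) := by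
    intro y; rw [← mul_assoc, ← gt_mul_idem_of_ne k (by omega) (by omega), mul_assoc]
  have g0' : idem d u 3 k 2 * gt d u 3 0 = gt d u 3 0 * idem d u 3 k 2 :=
    (gt_mul_idem_of_ne k (by omega) (by omega)).symm
  have b2 : idem d u 2 k 0 * idem d u 2 k 1 * gt d u 2 0 * idem d u 2 k 1
      = idem d u 2 k 0 * idem d u 2 k 1 * gt d u 2 0 := by
    rw [mul_assoc _ (gt _ _ _ _), gt_mul_idem_succ, ← mul_assoc, idem_comm k k 0, mul_assoc _
      (idem _ _ _ _ 0) (idem _ _ _ _ 0), idem_mul_self]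
  set P := idem d u 2 k 0 * idem d u 2 k 1 with hP
  have hP3 : idem d u 3 k 0 * idem d u 3 k 1 = incl d u 2 P := by rw [hP, map_mul, i0, i1]
  have P1 : P * idem d u 2 k 1 = P := by rw [hP, mul_assoc, idem_mul_self]
  have c1 : tr 3 (incl d u 2 P * idem d u 3 k 2) = frameWeight x k ^ 3 := by
    rw [h.map_incl_mul_idem hx, t2]; ring
  have c2 : tr 3 (incl d u 2 P * idem d u 3 k 2 * gt d u 3 0) = z * frameWeight x k ^ 2 := by
    rw [mul_assoc, g0', ← mul_assoc, ← ig, ← map_mul, h.map_incl_mul_idem hx, t2g]; ring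
  have c3 : tr 3 (incl d u 2 P * idem d u 3 k 2 * gt d u 3 1) = z * frameWeight x k ^ 2 := by
    rw [mul_assoc, g2', ← mul_assoc, ← i1, h.map_incl_mul_gt_mul_incl rfl, P1, t2]
  have c4 : tr 3 (incl d u 2 P * idem d u 3 k 2 * (gt d u 3 0 * gt d u 3 1))
      = z ^ 2 * frameWeight x k := by
    rw [mul_assoc, g0, g2', ← mul_assoc, ← mul_assoc, ← i1, ← ig, ← map_mul,
      h.map_incl_mul_gt_mul_incl rfl, b2, t2g]
    ring
  have c5 : tr 3 (incl d u 2 P * idem d u 3 k 2 * (gt d u 3 1 * gt d u 3 0))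
      = z ^ 2 * frameWeight x k := by
    rw [mul_assoc, g2, ← mul_assoc, ← i1, ← ig, ← map_mul,
      h.map_incl_mul_gt_mul_incl rfl, ← mul_assoc, P1, t2g]
    ring
  have c6 : tr 3 (incl d u 2 P * idem d u 3 k 2 * (gt d u 3 0 * gt d u 3 1 * gt d u 3 0))
      = z * (u * frameWeight x k ^ 2 + (u - 1) * (z * frameWeight x k)) := by
    rw [mul_assoc, mul_assoc (gt _ _ _ 0), g0, g2, ← mul_assoc, ← mul_assoc, ← i1, ← ig, ← map_mul,
      ← map_mul, h.map_incl_mul_gt_mul_incl rfl, ← mul_assoc, b2, t2gg]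
  rw [rIdem, zero_add, zero_add, hP3, ggt, zero_add]
  simp only [mul_add, mul_one, map_add, c1, c2, c3, c4, c5, c6]
  ring

/-- By cyclicity the elements `a` with `τ(b a) = 0` for all `b` are stable under multiplication on
both sides, so they include the whole ideal. -/
theorem passesToFTL_of_map_mul_rt {n : ℕ} (τ : YH d u n →ₗ[ℂ] ℂ)
    (hcomm : ∀ a b, τ (a * b) = τ (b * a))
    (hτ : ∀ i, i + 2 < n → ∀ b, τ (b * rt d u n i) = 0) : PassesToFTL τ := by
  have hker : ∀ a ∈ ftlIdeal d u n, ∀ b, τ (b * a) = 0 := by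
    intro a ha
    induction ha using TwoSidedIdeal.span_induction with
    | mem a ha =>
      obtain ⟨i, hi, rfl⟩ := ha
      intro b
      rw [r_eq_rt hi]
      exact hτ i hi b
    | zero => simp
    | add a a' _ _ h h' => intro b; rw [mul_add, map_add, h, h', add_zero]
    | neg a _ h =>
      intro b
      refine (congrArg τ (mul_neg b _)).trans ?_
      rw [map_neg, h, neg_zero]
    | left_absorb c a _ h => intro b; rw [← mul_assoc, h]
    | right_absorb c a _ h => intro b; rw [← mul_assoc, hcomm, ← mul_assoc, h]
  let q : YH d u n →ₗ[ℂ] FTL d u n := ((ftlIdeal d u n).ringCon.mkₐ ℂ).toLinearMap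
  have hq : Function.Surjective q := RingCon.mk'_surjective _
  -- A linear section of the quotient map gives the factorisation; it changes representatives only
  -- by elements of the ideal, where `τ` vanishes.
  obtain ⟨s, hs⟩ := q.exists_rightInverse_of_surjective (LinearMap.range_eq_top.mpr hq)
  refine ⟨τ ∘ₗ s, fun a => ?_⟩
  have h1 : q (s (q a)) = q a := LinearMap.congr_fun hs (q a)
  have h2 : s (q a) - a ∈ ftlIdeal d u n := by
    rw [TwoSidedIdeal.mem_iff, ← RingCon.eq]
    change q (s (q a) - a) = q 0
    rw [map_sub, h1, sub_self, map_zero]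
  have h3 := hker _ h2 1
  rw [one_mul, map_sub, sub_eq_zero] at h3
  exact h3

theorem map_mul_rt_of_passesToFTL {n : ℕ} {τ : YH d u n →ₗ[ℂ] ℂ} (hτ : PassesToFTL τ) {i : ℕ}
    (hi : i + 2 < n) (b : YH d u n) : τ (b * rt d u n i) = 0 := by
  obtain ⟨σ, hσ⟩ := hτ
  have h1 : rt d u n i ∈ ftlIdeal d u n :=
    TwoSidedIdeal.subset_span ⟨i, hi, (r_eq_rt hi).symm⟩
  have h2 : b * rt d u n i ∈ ftlIdeal d u n := TwoSidedIdeal.mul_mem_left _ _ _ h1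
  rw [TwoSidedIdeal.mem_iff, ← RingCon.eq] at h2
  rw [← hσ]
  have h3 : (ftlIdeal d u n).ringCon.mkₐ ℂ (b * rt d u n i) = 0 := h2
  rw [h3, map_zero]

theorem passesToFTL_iff (h : IsJuyumayaTrace d u z x tr) (hx : x 0 = 1) (hu : u ≠ 0) {n : ℕ}
    (hn : 3 ≤ n) :
    PassesToFTL (tr n) ↔ ∀ k, frameWeight x k *
      (frameWeight x k + z) * (frameWeight x k + (u + 1) * z) = 0 := by
  constructor
  · intro hp k
    -- Multiplying `r_{0,1}` by `E_k(t_0)` isolates the `k`-th factorised equation.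
    rw [← h.map_rIdem hx, ← h.map_rIdem_eq k hn, ← idem_mul_rt]
    exact map_mul_rt_of_passesToFTL hp (by omega) _
  · intro hw
    refine passesToFTL_of_map_mul_rt _ (h.comm n) fun i hi b => ?_
    exact h.map_mul_rt_eq_zero hx hu (fun k => (h.map_rIdem hx k).trans (hw k)) hn hi b

end IsJuyumayaTrace

end Quotient

/-! ### Solving for the parameters by Fourier inversion. -/

section Parameters

variable {d : ℕ} [NeZero d] {u z : ℂ} {x : ZMod d → ℂ}

theorem dft_eq_frameWeight (x : ZMod d → ℂ) (k : ZMod d) :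
    ZMod.dft x k = (d : ℂ) * frameWeight x k := by
  rw [frameWeight, ← mul_assoc, mul_one_div_cancel natCast_card_ne_zero, one_mul]

theorem mem_ftSupport {k : ZMod d} : k ∈ ftSupport x ↔ frameWeight x k ≠ 0 := by
  simp [ftSupport, dft_eq_frameWeight, natCast_card_ne_zero (d := d)]

theorem mem_ftD₁ {k : ZMod d} : k ∈ ftD₁ z x ↔ frameWeight x k ≠ 0 ∧ frameWeight x k = -z := by
  rw [ftD₁, Finset.mem_filter, mem_ftSupport, dft_eq_frameWeight,
    show -(d : ℂ) * z = d * (-z) by ring, mul_right_inj' natCast_card_ne_zero]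

theorem mem_ftD₂ {k : ZMod d} :
    k ∈ ftD₂ u z x ↔ frameWeight x k ≠ 0 ∧ frameWeight x k = -((u + 1) * z) := by
  rw [ftD₂, Finset.mem_filter, mem_ftSupport, dft_eq_frameWeight,
    show -(d : ℂ) * z * (u + 1) = d * (-((u + 1) * z)) by ring,
    mul_right_inj' natCast_card_ne_zero]

/-- If `z = 0`, the equation reads `w_k³ = 0` for all `k`, against `∑_k w_k = x_0 = 1`. -/
theorem ne_zero_of_frameWeight (hx : x 0 = 1)
    (hw : ∀ k, frameWeight x k * (frameWeight x k + z) * (frameWeight x k + (u + 1) * z) = 0) :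
    z ≠ 0 := by
  rintro rfl
  have h0 : ∀ k, frameWeight x k = 0 := by
    intro k
    have := hw k
    simpa using this
  have := sum_stdAddChar_mul_frameWeight x 0
  simp [h0, hx] at this

theorem disjoint_ftD (hu : u ≠ 0) (hz : z ≠ 0) : Disjoint (ftD₁ z x) (ftD₂ u z x) := by
  rw [Finset.disjoint_left]
  intro k h1 h2
  have e := (mem_ftD₁.mp h1).2.symm.trans (mem_ftD₂.mp h2).2
  have : u * z = 0 := by linear_combination e
  exact (mul_ne_zero hu hz) this

theorem union_ftD
    (hw : ∀ k, frameWeight x k * (frameWeight x k + z) * (frameWeight x k + (u + 1) * z) = 0) :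
    ftD₁ z x ∪ ftD₂ u z x = ftSupport x := by
  ext k
  rw [Finset.mem_union, mem_ftD₁, mem_ftD₂, mem_ftSupport, ← and_or_left, and_iff_left_iff_imp]
  intro h
  have := hw k
  simp only [mul_eq_zero, h, false_or] at this
  exact this.imp eq_neg_of_add_eq_zero_left eq_neg_of_add_eq_zero_left

open Classical in
theorem ite_sum_ftD (m : ZMod d) :
    ∑ k : ZMod d, (ZMod.stdAddChar (k * m) : ℂ) *
        (-z * ((if k ∈ ftD₁ z x then 1 else 0) + (u + 1) * (if k ∈ ftD₂ u z x then 1 else 0)))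
      = -z * (∑ k ∈ ftD₁ z x, ZMod.stdAddChar (k * m) +
          (u + 1) * ∑ k ∈ ftD₂ u z x, ZMod.stdAddChar (k * m)) := by
  have h : ∀ D : Finset (ZMod d), ∑ k ∈ D, (ZMod.stdAddChar (k * m) : ℂ)
      = ∑ k : ZMod d, if k ∈ D then (ZMod.stdAddChar (k * m) : ℂ) else 0 := by
    intro D; simp
  rw [h, h, Finset.mul_sum, ← Finset.sum_add_distrib, Finset.mul_sum]
  refine Finset.sum_congr rfl fun k _ => ?_
  split_ifs <;> ring

/-- Fourier coefficients are unique; this recovers the weights from the closed formula for `x`. -/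
theorem frameWeight_eq_of_sum {v : ZMod d → ℂ}
    (h : ∀ m, x m = ∑ k : ZMod d, (ZMod.stdAddChar (k * m) : ℂ) * v k) (k : ZMod d) :
    frameWeight x k = v k := by
  have hx : x = ZMod.dft.symm fun k => (d : ℂ) * v k := by
    ext m
    rw [ZMod.invDFT_apply, h m, Finset.smul_sum]
    refine Finset.sum_congr rfl fun k _ => ?_
    have := natCast_card_ne_zero (d := d)
    simp only [smul_eq_mul]
    field_simp
  rw [frameWeight, hx, LinearEquiv.apply_symm_apply, ← mul_assoc,
    one_div_mul_cancel natCast_card_ne_zero, one_mul]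

theorem frameWeight_condition_iff (hx : x 0 = 1) (hu : u ≠ 0) :
    (∀ k, frameWeight x k * (frameWeight x k + z) * (frameWeight x k + (u + 1) * z) = 0) ↔
      (∀ m : ZMod d, x m = -z * (∑ k ∈ ftD₁ z x, ZMod.stdAddChar (k * m) +
            (u + 1) * ∑ k ∈ ftD₂ u z x, ZMod.stdAddChar (k * m))) ∧
        (((ftD₁ z x).card : ℂ) + (u + 1) * ((ftD₂ u z x).card : ℂ) ≠ 0 ∧
          z = -1 / (((ftD₁ z x).card : ℂ) + (u + 1) * ((ftD₂ u z x).card : ℂ))) := by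
  classical
  constructor
  · intro hw
    have hz := ne_zero_of_frameWeight hx hw
    have hdisj := disjoint_ftD (x := x) hu hz
    have hw' : ∀ k, frameWeight x k
        = -z * ((if k ∈ ftD₁ z x then 1 else 0) + (u + 1) * (if k ∈ ftD₂ u z x then 1 else 0)) := by
      intro k
      by_cases h1 : k ∈ ftD₁ z x
      · have h2 := Finset.disjoint_left.mp hdisj h1
        simp [h1, h2, (mem_ftD₁.mp h1).2]
      by_cases h2 : k ∈ ftD₂ u z x
      · simp only [h1, h2, if_true, if_false, (mem_ftD₂.mp h2).2]; ring
      have h3 : k ∉ ftSupport x := by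
        rw [← union_ftD hw, Finset.mem_union]; tauto
      rw [mem_ftSupport, not_not] at h3
      simp [h1, h2, h3]
    have hform : ∀ m : ZMod d, x m = -z * (∑ k ∈ ftD₁ z x, ZMod.stdAddChar (k * m) +
        (u + 1) * ∑ k ∈ ftD₂ u z x, ZMod.stdAddChar (k * m)) := by
      intro m
      rw [← ite_sum_ftD, ← sum_stdAddChar_mul_frameWeight x m]
      exact Finset.sum_congr rfl fun k _ => by rw [hw' k]
    -- At `m = 0` the formula reads `1 = -z (|D₁| + (u+1)|D₂|)`, which gives both the nonvanishing
    -- and the value of `z`.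
    have h0 := hform 0
    simp only [hx, mul_zero, AddChar.map_zero_eq_one, Finset.sum_const, nsmul_eq_mul, mul_one] at h0
    have hne : ((ftD₁ z x).card : ℂ) + (u + 1) * ((ftD₂ u z x).card : ℂ) ≠ 0 := by
      intro h; rw [h, mul_zero] at h0; exact one_ne_zero h0
    refine ⟨hform, hne, ?_⟩
    rw [eq_div_iff hne]
    linear_combination h0
  · rintro ⟨hform, -⟩ k
    -- On `D₁` and `D₂` one of the last two factors vanishes by definition; off both sets the
    -- formula for `x` gives weight `0`.
    have hk := frameWeight_eq_of_sum (fun m => (hform m).trans (ite_sum_ftD m).symm) k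
    by_cases h1 : k ∈ ftD₁ z x
    · simp [(mem_ftD₁.mp h1).2]
    by_cases h2 : k ∈ ftD₂ u z x
    · simp [(mem_ftD₂.mp h2).2]
    · simp [hk, h1, h2]

end Parameters

theorem mainTheorem1 (d : ℕ) [NeZero d] (u : ℂ) (hu : u ≠ 0) (z : ℂ)
    (x : ZMod d → ℂ) (hx : x 0 = 1) :
    (∃! tr : ∀ n : ℕ, YH d u n →ₗ[ℂ] ℂ, IsJuyumayaTrace d u z x tr) ∧
    ∀ tr : ∀ n : ℕ, YH d u n →ₗ[ℂ] ℂ, IsJuyumayaTrace d u z x tr → ∀ n : ℕ, 3 ≤ n →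
      (PassesToFTL (tr n) ↔
        (∀ m : ZMod d, x m = -z * (∑ k ∈ ftD₁ z x, ZMod.stdAddChar (k * m) +
            (u + 1) * ∑ k ∈ ftD₂ u z x, ZMod.stdAddChar (k * m))) ∧
        (((ftD₁ z x).card : ℂ) + (u + 1) * ((ftD₂ u z x).card : ℂ) ≠ 0 ∧
          z = -1 / (((ftD₁ z x).card : ℂ) + (u + 1) * ((ftD₂ u z x).card : ℂ)))) ∧
      (PassesToFTL (tr n) →
        Disjoint (ftD₁ z x) (ftD₂ u z x) ∧
        ftD₁ z x ∪ ftD₂ u z x = ftSupport x) := by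
  refine ⟨existsUnique_juyumayaTrace d u z x hx, fun tr h n hn => ⟨?_, fun hp => ?_⟩⟩
  · rw [h.passesToFTL_iff hx hu hn, frameWeight_condition_iff hx hu]
  · have hw := (h.passesToFTL_iff hx hu hn).mp hp
    exact ⟨disjoint_ftD hu (ne_zero_of_frameWeight hx hw), union_ftD hw⟩
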